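/- **Theorem (Chern number as analytic index, translation-invariant case).** Let $K\in\mathbb N$ and let $\mathcal H=\ell^2(\mathbb Z^2\times\{1,\dots,K\})$ with orthonormal basis $|\mathbf n,\alpha\rangle$. For $\mathbf n=(n_1,n_2)\in\mathbb Z^2$ write $n=n_1+in_2\in\mathbb C$, and let $n_0=\tfrac12+\tfrac i2$. Let $T_{\mathbf a}|\mathbf n,\alpha\rangle=|\mathbf n+\mathbf a,\alpha\rangle$ be the lattice translations and let $u$ be the unitary operator $$u|\mathbf n,\alpha\rangle=\frac{n+n_0}{|n+n_0|}\,|\mathbf n,\alpha\rangle .$$ Call a bounded operator $\Pi$ on $\mathcal H$ a *localized projector* if $\Pi=\Pi^*=\Pi^2$, $T_{\mathbf a}\Pi=\Pi T_{\mathbf a}$ for all $\mathbf a\in\mathbb Z^2$, and there are constants $c$ and $\gamma>0$ with $$|\langle \mathbf n,\alpha|\Pi|\mathbf m,\beta\rangle|< c\,e^{-\gamma|\mathbf n-\mathbf m|}\qquad\text{for all }\mathbf n,\mathbf m,\alpha,\beta .$$ Let $\mathcal T=[0,2\pi]^2$, let $\xi_1,\dots,\xi_K$ be the standard basis of $\mathbb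 C^K$, and let $U:\mathcal H\to L^2(\mathcal T;\mathbb C^K)$ be the Bloch transformation, $(U|\mathbf n,\alpha\rangle)(\mathbf k)=\frac1{2\pi}e^{-i\mathbf k\cdot\mathbf n}\xi_\alpha$. For a localized projector $\Pi$ and $\mathbf k\in\mathbb R^2$ let $\hat\Pi_{\mathbf k}$ be the $K\times K$ matrix with entries $\sum_{\mathbf s\in\mathbb Z^2}e^{-i\mathbf k\cdot\mathbf s}\langle\mathbf s,\alpha|\Pi|\mathbf 0,\beta\rangle$, and put $$C(\Pi)=\frac1{2\pi i}\int_{\mathcal T}\operatorname{tr}\bigl\{\hat\Pi_{\mathbf k}[\partial_{k_1}\hat\Pi_{\mathbf k},\partial_{k_2}\hat\Pi_{\mathbf k}]\bigr\}\,d^2\mathbf k .$$ For a Fredholm operator $F$ on $\mathcal H$ let $\operatorname{Ind}F=\dim\ker F-\dim\ker F^*$. (1) For every localized projector $\Pi$: each $\hat\Pi_{\mathbf k}$ is an orthogonal projector on $\mathbb C^K$, its entries are real-analytic functions of $\mathbf k$, and $U\Pi U^{-1}=\bigoplus_{\mathbf k\in\mathcal T}\hat\Pi_{\mathbf k}$,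 that is, for every $\psi\in\mathcal H$, $(U\Pi\psi)(\mathbf k)=\hat\Pi_{\mathbf k}(U\psi)(\mathbf k)$ for almost every $\mathbf k\in\mathcal T$. The operator $(\Pi u\Pi)\oplus\Pi^\perp=\Pi u\Pi+(1-\Pi)$ is Fredholm, and $$\operatorname{Ind}\{(\Pi u\Pi)\oplus\Pi^\perp\}=-\,C(\Pi)=-\frac1{2\pi i}\int_{\mathcal T}\operatorname{tr}\bigl\{\hat\Pi_{\mathbf k}[\partial_{k_1}\hat\Pi_{\mathbf k},\partial_{k_2}\hat\Pi_{\mathbf k}]\bigr\}\,d^2\mathbf k .$$ In particular $C(\Pi)\in\mathbb Z$. (2) If $[a,b]\ni\tau\mapsto\Pi(\tau)$ is continuous in operator norm and every $\Pi(\tau)$ is a localized projector (with constants $c,\gamma$ that may depend on $\tau$), then $C(\Pi(s))=C(\Pi(t))$ for all $s,t\in[a,b]$. -/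

import Mathlib

noncomputable section

namespace ChernIndex

/-! ### The lattice Hilbert space -/

/-- The Hilbert space `ℋ = ℓ²(ℤ² × {1,…,K})` with orthonormal basis `|n, α⟩`. -/
abbrev H (K : ℕ) : Type := lp (fun _ : (ℤ × ℤ) × Fin K => ℂ) 2

/-- The basis vector `|n, α⟩`. -/
def ket {K : ℕ} (n : ℤ × ℤ) (α : Fin K) : H K := lp.single 2 (n, α) (1 : ℂ)

/-- The lattice point `n = (n₁, n₂)` regarded as the complex number `n₁ + i n₂`. -/
def site (n : ℤ × ℤ) : ℂ := (n.1 : ℂ) + (n.2 : ℂ) * Complex.I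

/-- The flux position `n₀ = 1/2 + i/2`. -/
def fluxPoint : ℂ := 1 / 2 + Complex.I / 2

/-- The phase `(n + n₀) / |n + n₀|`. -/
def phase (n : ℤ × ℤ) : ℂ := (site n + fluxPoint) / (‖site n + fluxPoint‖ : ℂ)

theorem site_add_fluxPoint_ne_zero (n : ℤ × ℤ) : site n + fluxPoint ≠ 0 := by
  intro h
  have h1 := congrArg Complex.re h
  simp [site, fluxPoint] at h1
  have h2 : (2 * n.1 + 1 : ℤ) = 0 := by
    have : (2 * (n.1 : ℝ) + 1) = 0 := by linarith
    exact_mod_cast this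
  omega

theorem norm_phase (n : ℤ × ℤ) : ‖phase n‖ = 1 := by
  have h : ‖site n + fluxPoint‖ ≠ 0 := norm_ne_zero_iff.mpr (site_add_fluxPoint_ne_zero n)
  simp [phase, div_self h]

theorem memℓp_of_norm_le {K : ℕ} {f : (ℤ × ℤ) × Fin K → ℂ} (ψ : H K)
    (e : Equiv.Perm ((ℤ × ℤ) × Fin K)) (h : ∀ x, ‖f x‖ = ‖ψ (e x)‖) :
    Memℓp f 2 := by
  have hψ := (lp.memℓp ψ).summable (by norm_num)
  refine memℓp_gen ?_
  simp only [h]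
  exact (e.summable_iff (f := fun x => ‖ψ x‖ ^ (2 : ENNReal).toReal)).mpr hψ

theorem norm_eq_of_perm {K : ℕ} (φ ψ : H K) (e : Equiv.Perm ((ℤ × ℤ) × Fin K))
    (h : ∀ x, ‖φ x‖ = ‖ψ (e x)‖) : ‖φ‖ = ‖ψ‖ := by
  rw [lp.norm_eq_tsum_rpow (by norm_num), lp.norm_eq_tsum_rpow (by norm_num)]
  congr 1
  simp only [h]
  exact e.tsum_eq (fun x => ‖ψ x‖ ^ (2 : ENNReal).toReal)

/-- The flux insertion unitary `u |n, α⟩ = (n + n₀)/|n + n₀| |n, α⟩`. -/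
def flux (K : ℕ) : H K ≃ₗᵢ[ℂ] H K where
  toFun ψ := ⟨fun x => phase x.1 * ψ x,
    memℓp_of_norm_le ψ (Equiv.refl _) (by simp [norm_phase])⟩
  invFun ψ := ⟨fun x => (phase x.1)⁻¹ * ψ x,
    memℓp_of_norm_le ψ (Equiv.refl _) (by simp [norm_phase])⟩
  map_add' φ ψ := by
    ext x
    simp [mul_add]
    rfl
  map_smul' c ψ := by
    ext x
    simp [mul_left_comm]
  left_inv ψ := by
    ext x
    have h : phase x.1 ≠ 0 := by
      rw [← norm_ne_zero_iff, norm_phase]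
      exact one_ne_zero
    simp [h]
  right_inv ψ := by
    ext x
    have h : phase x.1 ≠ 0 := by
      rw [← norm_ne_zero_iff, norm_phase]
      exact one_ne_zero
    simp [h]
  norm_map' ψ := norm_eq_of_perm _ ψ (Equiv.refl _) (by simp [norm_phase])

theorem flux_apply {K : ℕ} (ψ : H K) (x : (ℤ × ℤ) × Fin K) :
    flux K ψ x = phase x.1 * ψ x := rfl

theorem flux_ket {K : ℕ} (n : ℤ × ℤ) (α : Fin K) :
    flux K (ket n α) = phase n • ket n α := by
  ext x
  rw [flux_apply]
  by_cases h : x = (n, α)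
  · subst h
    simp [ket]
  · simp [ket, Pi.single_eq_of_ne h]

/-- The permutation `(n, α) ↦ (n - a, α)` of the index set. -/
def shift (K : ℕ) (a : ℤ × ℤ) : Equiv.Perm ((ℤ × ℤ) × Fin K) :=
  (Equiv.subRight a).prodCongr (Equiv.refl _)

/-- The lattice translation `T_a |n, α⟩ = |n + a, α⟩`. -/
def translation (K : ℕ) (a : ℤ × ℤ) : H K ≃ₗᵢ[ℂ] H K where
  toFun ψ := ⟨fun x => ψ (shift K a x), memℓp_of_norm_le ψ (shift K a) (fun _ => rfl)⟩
  invFun ψ := ⟨fun x => ψ ((shift K a).symm x),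
    memℓp_of_norm_le ψ (shift K a).symm (fun _ => rfl)⟩
  map_add' φ ψ := by
    ext x
    simp
    rfl
  map_smul' c ψ := by
    ext x
    simp
  left_inv ψ := by
    ext x
    simp
  right_inv ψ := by
    ext x
    simp
  norm_map' ψ := norm_eq_of_perm _ ψ (shift K a) (fun _ => rfl)

theorem translation_apply {K : ℕ} (a : ℤ × ℤ) (ψ : H K) (n : ℤ × ℤ) (α : Fin K) :
    translation K a ψ (n, α) = ψ (n - a, α) := rfl

theorem translation_ket {K : ℕ} (a n : ℤ × ℤ) (α : Fin K) :
    translation K a (ket n α) = ket (n + a) α := by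
  ext ⟨m, β⟩
  rw [translation_apply]
  simp only [ket, lp.coeFn_single, Pi.single_apply, Prod.mk.injEq, sub_eq_iff_eq_add]

/-! ### Projectors, Fredholm index -/

/-- A translation-invariant orthogonal projector whose matrix elements decay exponentially:
`|⟨n, α| P |m, β⟩| < C e^{-γ |n - m|}` for some `C` and some `γ > 0`. -/
structure IsLocalizedProjector {K : ℕ} (P : H K →L[ℂ] H K) : Prop where
  isStarProjection : IsStarProjection P
  translation_comm : ∀ (a : ℤ × ℤ) (ψ : H K), translation K a (P ψ) = P (translation K a ψ)
  exp_decay : ∃ C γ : ℝ, 0 < γ ∧ ∀ (n m : ℤ × ℤ) (α β : Fin K),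
    ‖inner ℂ (ket n α) (P (ket m β))‖ < C * Real.exp (-γ * ‖site n - site m‖)

/-- The operator `(P u P) ⊕ P^⊥` on `ℋ = Pℋ ⊕ P^⊥ℋ`, that is, `P u P + (1 - P)`. -/
def fluxCompression {K : ℕ} (P : H K →L[ℂ] H K) : H K →L[ℂ] H K :=
  P ∘L (flux K : H K →L[ℂ] H K) ∘L P + (ContinuousLinearMap.id ℂ (H K) - P)

/-- `Ind F = dim Null F - dim Null F*` (meaningful for Fredholm `F`). -/
def index {E : Type*} [NormedAddCommGroup E] [InnerProductSpace ℂ E] [CompleteSpace E]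
    (F : E →L[ℂ] E) : ℤ :=
  (Module.finrank ℂ F.ker : ℤ) - (Module.finrank ℂ (ContinuousLinearMap.adjoint F).ker : ℤ)

/-! ### Bloch transformation -/

open MeasureTheory

/-- The Brillouin torus `𝒯 = [0, 2π] × [0, 2π]`. -/
def brillouin : Set (ℝ × ℝ) := Set.Icc 0 (2 * Real.pi) ×ˢ Set.Icc 0 (2 * Real.pi)

/-- The pairing `k · n`. -/
def kdot (k : ℝ × ℝ) (n : ℤ × ℤ) : ℝ := k.1 * n.1 + k.2 * n.2

/-- The continuous direct sum `⊕_{k ∈ 𝒯} ℂ^K`, i.e. the space `L²(𝒯; ℂ^K)`. -/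
abbrev BlochSpace (K : ℕ) : Type :=
  Lp (EuclideanSpace ℂ (Fin K)) 2 (volume.restrict brillouin)

/-- The function `k ↦ (2π)⁻¹ e^{-i k·n} ξ_α`. -/
def blochWaveFun {K : ℕ} (n : ℤ × ℤ) (α : Fin K) (k : ℝ × ℝ) : EuclideanSpace ℂ (Fin K) :=
  ((1 / (2 * Real.pi) : ℂ) * Complex.exp (-Complex.I * (kdot k n : ℂ))) •
    EuclideanSpace.single α (1 : ℂ)

theorem isCompact_brillouin : IsCompact brillouin := isCompact_Icc.prod isCompact_Icc

theorem continuous_blochWaveFun {K : ℕ} (n : ℤ × ℤ) (α : Fin K) :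
    Continuous (blochWaveFun n α) := by
  unfold blochWaveFun kdot
  fun_prop

instance : IsFiniteMeasure ((volume : Measure (ℝ × ℝ)).restrict brillouin) :=
  ⟨by simpa using isCompact_brillouin.measure_lt_top⟩

theorem norm_blochWaveFun_le {K : ℕ} (n : ℤ × ℤ) (α : Fin K) (k : ℝ × ℝ) :
    ‖blochWaveFun n α k‖ ≤ 1 / (2 * Real.pi) := by
  unfold blochWaveFun
  rw [norm_smul, norm_mul, Complex.norm_exp]
  simp [abs_of_pos Real.pi_pos]

theorem memLp_blochWaveFun {K : ℕ} (n : ℤ × ℤ) (α : Fin K) :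
    MemLp (blochWaveFun n α) 2 (volume.restrict brillouin) :=
  MemLp.of_bound (continuous_blochWaveFun n α).aestronglyMeasurable _
    (Filter.Eventually.of_forall (norm_blochWaveFun_le n α))

/-- The Bloch wave `U |n, α⟩ = (2π)⁻¹ ⊕_k e^{-i k·n} ξ_α` as a vector of `⊕_k ℂ^K`. -/
def blochWave {K : ℕ} (x : (ℤ × ℤ) × Fin K) : BlochSpace K :=
  (memLp_blochWaveFun x.1 x.2).toLp _

theorem setIntegral_exp (j : ℤ) :
    ∫ t in Set.Icc (0 : ℝ) (2 * Real.pi), Complex.exp (Complex.I * j * t) =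
      if j = 0 then (2 * Real.pi : ℂ) else 0 := by
  rw [integral_Icc_eq_integral_Ioc, ← intervalIntegral.integral_of_le (by positivity)]
  split_ifs with h
  · subst h
    simp
  · have hj : Complex.I * (j : ℂ) ≠ 0 := by simp [h]
    rw [integral_exp_mul_complex hj]
    have : Complex.exp (Complex.I * j * ((2 * Real.pi : ℝ) : ℂ)) = 1 := by
      rw [Complex.exp_eq_one_iff]
      exact ⟨j, by push_cast; ring⟩
    rw [this]
    simp

theorem inner_blochWave {K : ℕ} (x y : (ℤ × ℤ) × Fin K) :
    inner ℂ (blochWave x) (blochWave y) = if x = y then (1 : ℂ) else 0 := by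
  obtain ⟨n, α⟩ := x
  obtain ⟨m, β⟩ := y
  have key : ∀ k : ℝ × ℝ, inner ℂ (blochWaveFun n α k) (blochWaveFun m β k) =
      (if α = β then (1 / (2 * Real.pi) : ℂ) ^ 2 else 0) *
        (Complex.exp (Complex.I * ((n.1 - m.1 : ℤ) : ℂ) * k.1) *
          Complex.exp (Complex.I * ((n.2 - m.2 : ℤ) : ℂ) * k.2)) := by
    intro k
    unfold blochWaveFun
    rw [inner_smul_left, inner_smul_right, EuclideanSpace.inner_single_left]
    have e : (starRingEnd ℂ) ((1 / (2 * Real.pi) : ℂ) *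
        Complex.exp (-Complex.I * (kdot k n : ℂ))) =
        (1 / (2 * Real.pi) : ℂ) * Complex.exp (Complex.I * (kdot k n : ℂ)) := by
      rw [map_mul, ← Complex.exp_conj]
      simp [Complex.conj_ofNat]
    rw [e]
    by_cases h : α = β
    · subst h
      simp only [map_one, if_true, PiLp.single_apply, mul_one]
      rw [← Complex.exp_add]
      have e2 : Complex.I * ((n.1 - m.1 : ℤ) : ℂ) * k.1 + Complex.I * ((n.2 - m.2 : ℤ) : ℂ) * k.2
          = Complex.I * (kdot k n : ℂ) + (-Complex.I * (kdot k m : ℂ)) := by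
        unfold kdot
        push_cast
        ring
      rw [e2, Complex.exp_add]
      ring
    · simp [h]
  have h1 : inner ℂ (blochWave (n, α)) (blochWave (m, β)) =
      ∫ k in brillouin, inner ℂ (blochWaveFun n α k) (blochWaveFun m β k) := by
    rw [L2.inner_def]
    refine integral_congr_ae ?_
    filter_upwards [(memLp_blochWaveFun n α).coeFn_toLp, (memLp_blochWaveFun m β).coeFn_toLp]
      with k hk hk'
    simp only [blochWave, hk, hk']
  rw [h1]
  simp only [key]
  rw [integral_const_mul, brillouin, Measure.volume_eq_prod,
    setIntegral_prod_mul (μ := volume) (ν := volume)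
      (fun t : ℝ => Complex.exp (Complex.I * ((n.1 - m.1 : ℤ) : ℂ) * t))
      (fun t : ℝ => Complex.exp (Complex.I * ((n.2 - m.2 : ℤ) : ℂ) * t)),
    setIntegral_exp, setIntegral_exp]
  have hpi : (Real.pi : ℂ) ≠ 0 := by exact_mod_cast Real.pi_ne_zero
  by_cases h : α = β <;> by_cases h2 : n.1 = m.1 <;> by_cases h3 : n.2 = m.2 <;>
    simp [h, h2, h3, sub_eq_zero, Prod.ext_iff]
  field_simp

theorem orthonormal_blochWave (K : ℕ) :
    Orthonormal ℂ (blochWave : (ℤ × ℤ) × Fin K → BlochSpace K) :=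
  orthonormal_iff_ite.mpr inner_blochWave

/-- The Bloch transformation `U : ℋ → ⊕_{k ∈ 𝒯} ℂ^K`: the isometry that sends `|n, α⟩` to the Bloch
wave `(2π)⁻¹ ⊕_k e^{-i k·n} ξ_α`. -/
def bloch (K : ℕ) : H K →ₗᵢ[ℂ] BlochSpace K :=
  (orthonormal_blochWave K).orthogonalFamily.linearIsometry

theorem bloch_ket {K : ℕ} (n : ℤ × ℤ) (α : Fin K) : bloch K (ket n α) = blochWave (n, α) := by
  unfold bloch ket
  rw [OrthogonalFamily.linearIsometry_apply_single]
  simp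

/-- `U P U⁻¹ = ⊕_k A_k`: the matrix family `A` is the Bloch decomposition of the operator `P`. -/
def IsBlochDecomposition {K : ℕ} (P : H K →L[ℂ] H K)
    (A : ℝ × ℝ → Matrix (Fin K) (Fin K) ℂ) : Prop :=
  ∀ ψ : H K, ∀ᵐ k ∂(volume.restrict brillouin),
    (bloch K (P ψ) : ℝ × ℝ → EuclideanSpace ℂ (Fin K)) k =
      Matrix.toEuclideanLin (A k) ((bloch K ψ : ℝ × ℝ → EuclideanSpace ℂ (Fin K)) k)

/-- The Bloch fibre `P̂_k`, with entries `∑_s e^{-i k·s} ⟨s, α| P |0, β⟩`. -/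
def blochFiber {K : ℕ} (P : H K →L[ℂ] H K) (k : ℝ × ℝ) : Matrix (Fin K) (Fin K) ℂ :=
  Matrix.of fun α β => ∑' s : ℤ × ℤ,
    Complex.exp (-Complex.I * (kdot k s : ℂ)) * inner ℂ (ket s α) (P (ket 0 β))

/-! ### The Chern number -/

/-- The entrywise partial derivative `∂A/∂k₁`. -/
def dk1 {K : ℕ} (A : ℝ × ℝ → Matrix (Fin K) (Fin K) ℂ) (k : ℝ × ℝ) :
    Matrix (Fin K) (Fin K) ℂ :=
  Matrix.of fun α β => deriv (fun t : ℝ => A (t, k.2) α β) k.1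

/-- The entrywise partial derivative `∂A/∂k₂`. -/
def dk2 {K : ℕ} (A : ℝ × ℝ → Matrix (Fin K) (Fin K) ℂ) (k : ℝ × ℝ) :
    Matrix (Fin K) (Fin K) ℂ :=
  Matrix.of fun α β => deriv (fun t : ℝ => A (k.1, t) α β) k.2

/-- The Chern number `(1/2πi) ∫_𝒯 tr (A_k [∂₁A_k, ∂₂A_k]) d²k`. -/
def chernNumber {K : ℕ} (A : ℝ × ℝ → Matrix (Fin K) (Fin K) ℂ) : ℂ :=
  1 / (2 * Real.pi * Complex.I) *
    ∫ k in brillouin, (A k * (dk1 A k * dk2 A k - dk2 A k * dk1 A k)).trace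

end ChernIndex

end

/-!
# The Chern number of a translation-invariant projector is a Fredholm index

Write `u` for the flux operator, `Q = u P u*` and `F = P u P + 1 - P`. The phase of `u` is nearly
constant far from the flux tube, so the matrix of `[P, u]` decays exponentially away from the
diagonal and like `1 / |x|` along it. The class of operators whose matrix decays exponentially away
from the diagonal and like `|x|⁻ᵏ` along it is graded under multiplication (`Decays.mul`), and for
`k = 3` the matrix is absolutely summable, because `|x|⁻³` is summable over `ℤ²`. For absolutely
summable matrices the trace is a sum over the diagonal, and its cyclicity is Fubini's theorem. No
theory of trace class operators is needed.

*Index as a trace.* The defects `1 - F*F` and `1 - FF*` are quadratic in commutators, so their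
squares have absolutely summable matrices. Hence `F` is Fredholm, and Fedosov's formula
`Ind F = Tr (1 - F*F)² - Tr (1 - FF*)²` holds (`index_eq_diagSum`). The difference between
`(1 - F*F) - (1 - FF*)` and the same expression with squares is, up to a commutator with `u*` whose
diagonal vanishes, a sum of two operators of trace zero. This gives `Ind F = -Tr (P - Q)³` as a
convergent sum over the diagonal (`IsLocalizedProjector.hasSum_diag_pow_three`).

*Area formula.* The matrix of `P - Q` is that of `P` times `1 - φ(x) φ̄(y)`, where `φ` is the phase.
By translation invariance `Tr (P - Q)³` becomes a sum over pairs of hopping vectors `s`, `t` of the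
trace of a product of three hopping matrices times `∑ₐ (1 - φ(a) φ̄(a+s+t)) (1 - φ(a+s+t) φ̄(a+t))
(1 - φ(a+t) φ̄(a))`. Connes' formula evaluates this sum as `2πi (s₁t₂ - s₂t₁)`
(`hasSum_one_sub_phase_mul`). Indeed the summand is, up to the factor `-2i`, the sum of the sines of
the angles under which the three sides of a triangle are seen. Summed over translates it becomes a
2-cocycle on `ℤ²`, which is antisymmetric because the point reflection at the flux tube preserves
the lattice. An antisymmetric 2-cocycle is biadditive, hence a multiple of the determinant. The
multiple is found by adding the sines over all unit squares, which telescopes to the boundary of a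
large square, seen under a full turn.

*Fourier series.* The entries of the fibre `P̂_k` are Fourier series with the hopping matrices as
coefficients, and the derivatives `∂₁`, `∂₂` multiply these by `-i s₁`, `-i s₂`. Integration over the
torus keeps the triples of hopping vectors that add up to zero, and the result is the lattice sum
above (`IsLocalizedProjector.chernNumber_blochFiber`). Analyticity of the entries is exponential
decay of the coefficients, and the algebraic properties of `P̂_k` are those of `P`, written as
convolution identities.

*Homotopy invariance.* The index is locally constant on Fredholm operators
(`exists_index_eq_of_norm_sub_lt`), so it is constant along a norm-continuous path of localized
projectors.
-/

noncomputable section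

namespace ChernIndex

section

/-! ### Matrix entries of operators on `ℓ²` -/

/-- The Hilbert space `ℓ²(ι)`. -/
abbrev Ell2 (ι : Type*) : Type _ := lp (fun _ : ι => ℂ) 2

section Entries

variable {ι : Type*} [DecidableEq ι]

/-- The matrix entry `⟨x| T |y⟩` of a bounded operator on `ℓ²(ι)`. -/
def entry (T : Ell2 ι →L[ℂ] Ell2 ι) (x y : ι) : ℂ := T (lp.single 2 y (1 : ℂ)) x

theorem inner_single_one_left (x : ι) (ψ : Ell2 ι) :
    inner ℂ (lp.single 2 x (1 : ℂ) : Ell2 ι) ψ = ψ x := by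
  rw [lp.inner_single_left]
  simp

theorem entry_eq_inner (T : Ell2 ι →L[ℂ] Ell2 ι) (x y : ι) :
    entry T x y = inner ℂ (lp.single 2 x (1 : ℂ) : Ell2 ι) (T (lp.single 2 y (1 : ℂ))) :=
  (inner_single_one_left _ _).symm

theorem norm_single_one (x : ι) : ‖(lp.single 2 x (1 : ℂ) : Ell2 ι)‖ = 1 := by
  rw [lp.norm_single (by norm_num)]
  simp

theorem norm_entry_le (T : Ell2 ι →L[ℂ] Ell2 ι) (x y : ι) : ‖entry T x y‖ ≤ ‖T‖ := by
  rw [entry_eq_inner]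
  refine (norm_inner_le_norm _ _).trans ?_
  rw [norm_single_one, one_mul]
  refine (T.le_opNorm _).trans ?_
  rw [norm_single_one, mul_one]

/-- The matrix entry as a continuous functional of the operator. -/
def entryL (x y : ι) : (Ell2 ι →L[ℂ] Ell2 ι) →L[ℂ] ℂ :=
  (innerSL ℂ (lp.single 2 x (1 : ℂ) : Ell2 ι)) ∘L
    ContinuousLinearMap.apply ℂ (Ell2 ι) (lp.single 2 y (1 : ℂ))

theorem entryL_apply (x y : ι) (T : Ell2 ι →L[ℂ] Ell2 ι) : entryL x y T = entry T x y := by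
  rw [entry_eq_inner]
  rfl

theorem entry_add (S T : Ell2 ι →L[ℂ] Ell2 ι) (x y : ι) :
    entry (S + T) x y = entry S x y + entry T x y := by simp [entry]

theorem entry_sub (S T : Ell2 ι →L[ℂ] Ell2 ι) (x y : ι) :
    entry (S - T) x y = entry S x y - entry T x y := by simp [entry]

theorem entry_one (x y : ι) :
    entry (1 : Ell2 ι →L[ℂ] Ell2 ι) x y = if x = y then 1 else 0 := by
  simp [entry, Pi.single_apply]

theorem entry_adjoint (T : Ell2 ι →L[ℂ] Ell2 ι) (x y : ι) :
    entry (ContinuousLinearMap.adjoint T) x y = starRingEnd ℂ (entry T y x) := by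
  rw [entry_eq_inner, entry_eq_inner, ContinuousLinearMap.adjoint_inner_right, inner_conj_symm]

theorem hasSum_entry_smul (T : Ell2 ι →L[ℂ] Ell2 ι) (y : ι) :
    HasSum (fun z => entry T z y • (lp.single 2 z (1 : ℂ) : Ell2 ι)) (T (lp.single 2 y (1 : ℂ))) := by
  have h := lp.hasSum_single (p := 2) (by norm_num) (T (lp.single 2 y (1 : ℂ)))
  refine h.congr_fun ?_
  intro z
  rw [← lp.single_smul]
  simp [entry]

theorem hasSum_entry_mul (S T : Ell2 ι →L[ℂ] Ell2 ι) (x y : ι) :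
    HasSum (fun z => entry S x z * entry T z y) (entry (S * T) x y) := by
  have h := (hasSum_entry_smul T y).mapL (innerSL ℂ (lp.single 2 x (1 : ℂ) : Ell2 ι) ∘L S)
  have e : entry (S * T) x y =
      (innerSL ℂ (lp.single 2 x (1 : ℂ) : Ell2 ι) ∘L S) (T (lp.single 2 y (1 : ℂ))) := by
    rw [entry_eq_inner]
    rfl
  rw [e]
  refine h.congr_fun fun z => ?_
  rw [map_smul, smul_eq_mul, mul_comm, entry_eq_inner S]
  rfl

theorem ext_entry {S T : Ell2 ι →L[ℂ] Ell2 ι} (h : ∀ x y, entry S x y = entry T x y) : S = T := by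
  have hs : ∀ y, S (lp.single 2 y (1 : ℂ)) = T (lp.single 2 y (1 : ℂ)) := by
    intro y
    ext x
    exact h x y
  ext1 ψ
  have hψ := lp.hasSum_single (p := 2) (by norm_num) ψ
  refine (hψ.mapL S).unique ?_
  convert hψ.mapL T using 2 with y
  have : lp.single 2 y (ψ y) = ψ y • (lp.single 2 y (1 : ℂ) : Ell2 ι) := by
    rw [← lp.single_smul]
    simp
  rw [this, map_smul, map_smul, hs]

/-! ### Diagonal sums of operators with summable matrix -/

/-- The matrix of `T` is absolutely summable. Such an operator is trace class; this stronger
condition is all that is needed here and makes the cyclicity of the trace an instance of Fubini. -/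
def SummableEntries (T : Ell2 ι →L[ℂ] Ell2 ι) : Prop :=
  Summable fun p : ι × ι => ‖entry T p.1 p.2‖

/-- The trace `∑ₓ ⟨x| T |x⟩`, junk when the diagonal is not summable. -/
def diagSum (T : Ell2 ι →L[ℂ] Ell2 ι) : ℂ := ∑' x, entry T x x

theorem SummableEntries.hasSum_diag_mul_left {Z : Ell2 ι →L[ℂ] Ell2 ι} (hZ : SummableEntries Z)
    (T : Ell2 ι →L[ℂ] Ell2 ι) :
    HasSum (fun x => entry (T * Z) x x) (∑' p : ι × ι, entry Z p.1 p.2 * entry T p.2 p.1) := by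
  have hs : Summable fun p : ι × ι => entry Z p.1 p.2 * entry T p.2 p.1 := by
    refine Summable.of_norm_bounded (hZ.mul_right ‖T‖) fun p => ?_
    rw [norm_mul]
    exact mul_le_mul_of_nonneg_left (norm_entry_le _ _ _) (norm_nonneg _)
  have h2 := (Equiv.prodComm ι ι).hasSum_iff.mpr hs.hasSum
  refine h2.prod_fiberwise fun x => ?_
  refine (hasSum_entry_mul T Z x x).congr_fun fun z => ?_
  simp [mul_comm]

theorem SummableEntries.hasSum_diag_mul_right {Z : Ell2 ι →L[ℂ] Ell2 ι} (hZ : SummableEntries Z)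
    (T : Ell2 ι →L[ℂ] Ell2 ι) :
    HasSum (fun x => entry (Z * T) x x) (∑' p : ι × ι, entry Z p.1 p.2 * entry T p.2 p.1) := by
  have hs : Summable fun p : ι × ι => entry Z p.1 p.2 * entry T p.2 p.1 := by
    refine Summable.of_norm_bounded (hZ.mul_right ‖T‖) fun p => ?_
    rw [norm_mul]
    exact mul_le_mul_of_nonneg_left (norm_entry_le _ _ _) (norm_nonneg _)
  exact hs.hasSum.prod_fiberwise fun x => hasSum_entry_mul Z T x x

theorem SummableEntries.summable_diag {Z : Ell2 ι →L[ℂ] Ell2 ι} (hZ : SummableEntries Z) :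
    Summable fun x => entry Z x x := by
  have h := (hZ.hasSum_diag_mul_left 1).summable
  rwa [one_mul] at h

theorem SummableEntries.diagSum_mul_comm {Z : Ell2 ι →L[ℂ] Ell2 ι} (hZ : SummableEntries Z)
    (T : Ell2 ι →L[ℂ] Ell2 ι) : diagSum (T * Z) = diagSum (Z * T) :=
  (hZ.hasSum_diag_mul_left T).tsum_eq.trans (hZ.hasSum_diag_mul_right T).tsum_eq.symm

theorem diagSum_sub {S T : Ell2 ι →L[ℂ] Ell2 ι} (hS : Summable fun x => entry S x x)
    (hT : Summable fun x => entry T x x) : diagSum (S - T) = diagSum S - diagSum T := by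
  unfold diagSum
  simp only [entry_sub]
  exact hS.tsum_sub hT

/-- The diagonal of an orthogonal projection onto a finite-dimensional subspace sums to the
dimension, by Parseval. -/
theorem hasSum_entry_starProjection (W : Submodule ℂ (Ell2 ι)) [FiniteDimensional ℂ W] :
    HasSum (fun x => entry W.starProjection x x) (Module.finrank ℂ W : ℂ) := by
  set b := stdOrthonormalBasis ℂ W
  have h1 : ∀ x, entry W.starProjection x x =
      ∑ i, inner ℂ ((b i : W) : Ell2 ι) (lp.single 2 x (1 : ℂ)) *
        inner ℂ (lp.single 2 x (1 : ℂ)) ((b i : W) : Ell2 ι) := by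
    intro x
    rw [entry_eq_inner, b.starProjection_eq_sum_rankOne]
    simp
  have h2 : ∀ i, HasSum (fun x => inner ℂ ((b i : W) : Ell2 ι) (lp.single 2 x (1 : ℂ)) *
        inner ℂ (lp.single 2 x (1 : ℂ)) ((b i : W) : Ell2 ι)) 1 := by
    intro i
    have := lp.hasSum_inner (𝕜 := ℂ) ((b i : W) : Ell2 ι) ((b i : W) : Ell2 ι)
    have hb : inner ℂ ((b i : W) : Ell2 ι) ((b i : W) : Ell2 ι) = (1 : ℂ) := by
      rw [inner_self_eq_norm_sq_to_K]
      have := b.orthonormal.1 i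
      rw [Submodule.coe_norm] at this
      simp [this]
    rw [hb] at this
    refine this.congr_fun fun x => ?_
    rw [inner_single_one_left, ← inner_conj_symm, inner_single_one_left]
    simp [Complex.conj_mul']
  have h3 := hasSum_sum (s := Finset.univ) fun i _ => h2 i
  simp only [Finset.sum_const, Finset.card_univ, Fintype.card_fin, nsmul_eq_mul, mul_one] at h3
  exact h3.congr_fun h1

/-- An operator with absolutely summable matrix is a norm limit of finite-rank operators: the
partial sums of its expansion in matrix units converge in norm. -/
theorem SummableEntries.exists_finiteRange_norm_sub_lt {Z : Ell2 ι →L[ℂ] Ell2 ι}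
    (hZ : SummableEntries Z) {ε : ℝ} (hε : 0 < ε) :
    ∃ R : Ell2 ι →L[ℂ] Ell2 ι, (R : Ell2 ι →ₗ[ℂ] Ell2 ι).HasFiniteRange ∧ ‖Z - R‖ < ε := by
  set E : ι × ι → (Ell2 ι →L[ℂ] Ell2 ι) := fun p =>
    (innerSL ℂ (lp.single 2 p.2 (1 : ℂ) : Ell2 ι)).smulRight (lp.single 2 p.1 (1 : ℂ))
  have hE : ∀ p, ‖E p‖ = 1 := by
    intro p
    simp only [E, ContinuousLinearMap.norm_smulRight_apply, innerSL_apply_norm, norm_single_one,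
      mul_one]
  have hfin : ∀ p, (E p : Ell2 ι →ₗ[ℂ] Ell2 ι).HasFiniteRange := by
    intro p
    have : (E p : Ell2 ι →ₗ[ℂ] Ell2 ι) =
        (LinearMap.toSpanSingleton ℂ (Ell2 ι) (lp.single 2 p.1 (1 : ℂ))) ∘ₗ
          (innerSL ℂ (lp.single 2 p.2 (1 : ℂ) : Ell2 ι) : Ell2 ι →ₗ[ℂ] ℂ) := by
      ext ψ
      simp [E]
    rw [this]
    exact LinearMap.HasFiniteRange.comp_right (LinearMap.HasFiniteRange.of_finite_dom) _
  have hs : Summable fun p : ι × ι => entry Z p.1 p.2 • E p := by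
    refine Summable.of_norm ?_
    refine hZ.congr fun p => ?_
    rw [norm_smul, hE, mul_one]
  have hEentry : ∀ (p : ι × ι) x y, entry (E p) x y = if (x, y) = p then 1 else 0 := by
    rintro ⟨a, b⟩ x y
    simp only [entry, E, ContinuousLinearMap.smulRight_apply, innerSL_apply_apply,
      inner_single_one_left, lp.coeFn_smul, Pi.smul_apply, lp.coeFn_single, smul_eq_mul]
    rw [Pi.single_apply, Pi.single_apply]
    simp only [Prod.mk.injEq]
    simp only [eq_comm (a := b)]
    by_cases h1 : x = a <;> by_cases h2 : y = b <;> simp [h1, h2]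
  have hsum : HasSum (fun p : ι × ι => entry Z p.1 p.2 • E p) Z := by
    convert hs.hasSum using 1
    refine ext_entry fun x y => ?_
    rw [← entryL_apply x y (∑' p : ι × ι, _), ContinuousLinearMap.map_tsum _ hs,
      tsum_eq_single (x, y)]
    · simp [entryL_apply, hEentry]
    · intro p hp
      simp [entryL_apply, hEentry, hp.symm]
  obtain ⟨s, hs'⟩ := ((Metric.tendsto_nhds.mp hsum) ε hε).exists
  refine ⟨∑ p ∈ s, entry Z p.1 p.2 • E p, ?_, ?_⟩
  · rw [ContinuousLinearMap.toLinearMap_sum, ← LinearMap.mem_finiteRange_iff_hasFiniteRange]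
    exact Submodule.sum_mem _ fun p _ => Submodule.smul_mem _ _
      (LinearMap.mem_finiteRange_iff_hasFiniteRange.mpr (hfin p))
  · rw [← dist_eq_norm, dist_comm]
    exact hs'

end Entries

end

section

/-! ### Weights on the lattice -/

theorem site_add (n m : ℤ × ℤ) : site (n + m) = site n + site m := by
  simp only [site, Prod.fst_add, Prod.snd_add]
  push_cast
  ring

theorem site_sub (n m : ℤ × ℤ) : site (n - m) = site n - site m := by
  simp only [site, Prod.fst_sub, Prod.snd_sub]
  push_cast
  ring

theorem site_zero : site 0 = 0 := by simp [site]

theorem site_re (n : ℤ × ℤ) : (site n).re = n.1 := by simp [site]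

theorem site_im (n : ℤ × ℤ) : (site n).im = n.2 := by simp [site]

/-- The distance `|n + n₀|` from the lattice point to the flux tube. -/
def fluxDist (n : ℤ × ℤ) : ℝ := ‖site n + fluxPoint‖

theorem half_le_abs_intCast_add_half (m : ℤ) : 1 / 2 ≤ |(m : ℝ) + 1 / 2| := by
  rcases le_or_gt 0 m with h | h
  · have : (0 : ℝ) ≤ m := by exact_mod_cast h
    rw [abs_of_nonneg (by linarith)]
    linarith
  · have : (m : ℝ) ≤ -1 := by exact_mod_cast Int.le_sub_one_of_lt h
    rw [abs_of_nonpos (by linarith)]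
    linarith

theorem abs_intCast_le (m : ℤ) : |(m : ℝ)| ≤ 2 * |(m : ℝ) + 1 / 2| := by
  have h1 := half_le_abs_intCast_add_half m
  have h2 : |(m : ℝ)| ≤ |(m : ℝ) + 1 / 2| + 1 / 2 := by
    have := abs_sub ((m : ℝ) + 1 / 2) (1 / 2)
    rwa [add_sub_cancel_right, abs_of_pos (by norm_num : (0 : ℝ) < 1 / 2)] at this
  linarith

theorem abs_fst_add_half_le_fluxDist (n : ℤ × ℤ) : |(n.1 : ℝ) + 1 / 2| ≤ fluxDist n := by
  have h := Complex.abs_re_le_norm (site n + fluxPoint)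
  have e : (site n + fluxPoint).re = (n.1 : ℝ) + 1 / 2 := by simp [site, fluxPoint]
  rwa [e] at h

theorem abs_snd_add_half_le_fluxDist (n : ℤ × ℤ) : |(n.2 : ℝ) + 1 / 2| ≤ fluxDist n := by
  have h := Complex.abs_im_le_norm (site n + fluxPoint)
  have e : (site n + fluxPoint).im = (n.2 : ℝ) + 1 / 2 := by simp [site, fluxPoint]
  rwa [e] at h

theorem half_le_fluxDist (n : ℤ × ℤ) : 1 / 2 ≤ fluxDist n :=
  (half_le_abs_intCast_add_half n.1).trans (abs_fst_add_half_le_fluxDist n)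

theorem fluxDist_pos (n : ℤ × ℤ) : 0 < fluxDist n :=
  lt_of_lt_of_le (by norm_num) (half_le_fluxDist n)

theorem fluxDist_le_add (n m : ℤ × ℤ) : fluxDist n ≤ fluxDist m + ‖site n - site m‖ := by
  have e : site n + fluxPoint = (site m + fluxPoint) + (site n - site m) := by ring
  unfold fluxDist
  rw [e]
  exact norm_add_le _ _

/-- The weight `|n + n₀|⁻¹` varies subexponentially, so that it may be moved along an
exponentially decaying kernel. -/
theorem inv_fluxDist_le {ε : ℝ} (hε : 0 < ε) (n m : ℤ × ℤ) :
    (fluxDist m)⁻¹ ≤ (1 + 2 / ε) * Real.exp (ε * ‖site n - site m‖) * (fluxDist n)⁻¹ := by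
  set d := ‖site n - site m‖
  have hd : 0 ≤ d := norm_nonneg _
  have hm := fluxDist_pos m
  have hn := fluxDist_pos n
  have h1 : fluxDist n ≤ fluxDist m * (1 + 2 * d) := by
    have := fluxDist_le_add n m
    nlinarith [half_le_fluxDist m]
  have h2 : 1 + 2 * d ≤ (1 + 2 / ε) * Real.exp (ε * d) := by
    have h3 := Real.add_one_le_exp (ε * d)
    have h4 : (1 + 2 / ε) * (ε * d + 1) = 1 + 2 * d + (ε * d + 2 / ε) := by
      field_simp
      ring
    have h5 : (1 + 2 / ε) * (ε * d + 1) ≤ (1 + 2 / ε) * Real.exp (ε * d) :=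
      mul_le_mul_of_nonneg_left h3 (by positivity)
    have : 0 ≤ ε * d + 2 / ε := by positivity
    linarith
  rw [inv_eq_one_div, ← div_eq_mul_inv, div_le_div_iff₀ hm hn, one_mul]
  calc fluxDist n ≤ fluxDist m * (1 + 2 * d) := h1
    _ ≤ fluxDist m * ((1 + 2 / ε) * Real.exp (ε * d)) := mul_le_mul_of_nonneg_left h2 hm.le
    _ = _ := by ring

theorem summable_inv_fluxDist_pow : Summable fun n : ℤ × ℤ => (fluxDist n)⁻¹ ^ 3 := by
  have h := EisensteinSeries.summable_one_div_norm_rpow (k := 3) (by norm_num)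
  rw [← (finTwoArrowEquiv ℤ).symm.summable_iff] at h
  have h2 := h.mul_left 8
  refine Summable.of_norm_bounded_eventually h2 ?_
  have hcof : ∀ᶠ n : ℤ × ℤ in Filter.cofinite, n ≠ 0 := by
    simp [Filter.eventually_cofinite]
  filter_upwards [hcof] with n hn
  simp only [Function.comp_apply, finTwoArrowEquiv_symm_apply]
  set N := ‖![n.1, n.2]‖ with hN
  have hNpos : 0 < N := by
    rw [hN, norm_pos_iff]
    intro h0
    apply hn
    have h1 := congrFun h0 0
    have h2 := congrFun h0 1
    simp at h1 h2
    exact Prod.ext h1 h2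
  have hle : N ≤ 2 * fluxDist n := by
    rw [hN, pi_norm_le_iff_of_nonneg (by linarith [fluxDist_pos n])]
    intro i
    fin_cases i
    · simp only [Fin.zero_eta, Matrix.cons_val_zero, Int.norm_eq_abs]
      linarith [abs_intCast_le n.1, abs_fst_add_half_le_fluxDist n]
    · simp only [Fin.mk_one, Matrix.cons_val_one, Matrix.cons_val_zero, Int.norm_eq_abs]
      linarith [abs_intCast_le n.2, abs_snd_add_half_le_fluxDist n]
  have hp := fluxDist_pos n
  rw [Real.norm_of_nonneg (by positivity), Real.rpow_neg hNpos.le]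
  have : N ^ (3 : ℝ) = N ^ 3 := by exact_mod_cast Real.rpow_natCast N 3
  rw [this]
  have h3 : (fluxDist n)⁻¹ ≤ 2 * N⁻¹ := by
    rw [inv_eq_one_div, ← div_eq_mul_inv, div_le_div_iff₀ hp hNpos]
    linarith
  calc (fluxDist n)⁻¹ ^ 3 ≤ (2 * N⁻¹) ^ 3 := by gcongr
    _ = 8 * (N ^ 3)⁻¹ := by
      rw [mul_pow, inv_pow]
      norm_num

theorem summable_exp_neg_norm_site {δ : ℝ} (hδ : 0 < δ) :
    Summable fun n : ℤ × ℤ => Real.exp (-δ * ‖site n‖) := by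
  have hε : 0 < δ / 3 := by positivity
  refine Summable.of_nonneg_of_le (fun n => (Real.exp_pos _).le) (fun n => ?_)
    (summable_inv_fluxDist_pow.mul_left ((fluxDist 0 * (1 + 2 / (δ / 3))) ^ 3))
  have h := inv_fluxDist_le hε n 0
  rw [site_zero, sub_zero] at h
  have h0 := fluxDist_pos 0
  have h1 : Real.exp (-(δ / 3) * ‖site n‖) ≤ fluxDist 0 * (1 + 2 / (δ / 3)) * (fluxDist n)⁻¹ := by
    rw [neg_mul, Real.exp_neg]
    rw [inv_le_iff_one_le_mul₀ (Real.exp_pos _)]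
    have := mul_le_mul_of_nonneg_left h h0.le
    rw [mul_inv_cancel₀ h0.ne'] at this
    linarith
  calc Real.exp (-δ * ‖site n‖) = Real.exp (-(δ / 3) * ‖site n‖) ^ 3 := by
        rw [← Real.exp_nat_mul]
        congr 1
        push_cast
        ring
    _ ≤ (fluxDist 0 * (1 + 2 / (δ / 3)) * (fluxDist n)⁻¹) ^ 3 := by
        gcongr
    _ = _ := by rw [mul_pow]

variable {K : ℕ}

/-- The sum `∑_y e^{-δ|x - y|}` over the index set of `H K`, which does not depend on `x`; it is
written for `x = 0`. -/
def expSum (K : ℕ) (δ : ℝ) : ℝ := ∑' y : (ℤ × ℤ) × Fin K, Real.exp (-δ * ‖site y.1‖)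

theorem hasSum_exp_site_sub (K : ℕ) {δ : ℝ} (hδ : 0 < δ) (n : ℤ × ℤ) :
    HasSum (fun y : (ℤ × ℤ) × Fin K => Real.exp (-δ * ‖site n - site y.1‖)) (expSum K δ) := by
  have h : Summable fun y : (ℤ × ℤ) × Fin K => Real.exp (-δ * ‖site y.1‖) := by
    have := (summable_exp_neg_norm_site hδ).mul_of_nonneg
      (Summable.of_finite (f := fun _ : Fin K => (1 : ℝ))) (fun _ => (Real.exp_pos _).le)
      (fun _ => zero_le_one)
    simpa using this
  have h2 := (((Equiv.subLeft n).prodCongr (Equiv.refl (Fin K))).hasSum_iff).mpr h.hasSum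
  refine h2.congr_fun fun y => ?_
  simp [site_sub]

/-! ### Operators with decaying matrix -/

/-- The matrix of `T` decays exponentially away from the diagonal and like `|x + n₀|⁻ᵏ` along it. -/
def Decays (k : ℕ) (T : H K →L[ℂ] H K) : Prop :=
  ∃ C γ : ℝ, 0 ≤ C ∧ 0 < γ ∧ ∀ x y : (ℤ × ℤ) × Fin K,
    ‖entry T x y‖ ≤ C * Real.exp (-γ * ‖site x.1 - site y.1‖) * (fluxDist x.1)⁻¹ ^ k

theorem Decays.add {k : ℕ} {S T : H K →L[ℂ] H K} (hS : Decays k S) (hT : Decays k T) :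
    Decays k (S + T) := by
  obtain ⟨C, γ, hC, hγ, h⟩ := hS
  obtain ⟨C', γ', hC', hγ', h'⟩ := hT
  refine ⟨C + C', min γ γ', by positivity, lt_min hγ hγ', fun x y => ?_⟩
  rw [entry_add]
  refine (norm_add_le _ _).trans ?_
  rw [add_mul, add_mul]
  have hw := (inv_pos.mpr (fluxDist_pos x.1)).le
  refine add_le_add ((h x y).trans ?_) ((h' x y).trans ?_)
  · gcongr
    exact min_le_left _ _
  · gcongr
    exact min_le_right _ _

theorem Decays.neg {k : ℕ} {T : H K →L[ℂ] H K} (hT : Decays k T) : Decays k (-T) := by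
  obtain ⟨C, γ, hC, hγ, h⟩ := hT
  refine ⟨C, γ, hC, hγ, fun x y => ?_⟩
  have : entry (-T) x y = -entry T x y := by simp [entry]
  rw [this, norm_neg]
  exact h x y

theorem Decays.sub {k : ℕ} {S T : H K →L[ℂ] H K} (hS : Decays k S) (hT : Decays k T) :
    Decays k (S - T) := by
  rw [sub_eq_add_neg]
  exact hS.add hT.neg

/-- Orders of decay along the diagonal add up under multiplication. -/
theorem Decays.mul {j k : ℕ} {S T : H K →L[ℂ] H K} (hS : Decays j S) (hT : Decays k T) :
    Decays (j + k) (S * T) := by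
  obtain ⟨C, γ, hC, hγ, h⟩ := hS
  obtain ⟨C', γ', hC', hγ', h'⟩ := hT
  set ε := γ / (2 * (k + 1)) with hεdef
  have hε : 0 < ε := by positivity
  have hkε : k * ε ≤ γ / 2 := by
    rw [hεdef, mul_div_assoc', div_le_div_iff₀ (by positivity) (by positivity)]
    nlinarith
  set M := 1 + 2 / ε with hM
  have hMpos : 0 < M := by positivity
  set δ := min (γ / 2) γ' with hδdef
  have hδ : 0 < δ := lt_min (by positivity) hγ'
  have hδ1 : δ ≤ γ / 2 := min_le_left _ _
  have hδ2 : δ ≤ γ' := min_le_right _ _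
  have hL : 0 ≤ expSum K (δ / 2) := tsum_nonneg fun _ => (Real.exp_pos _).le
  refine ⟨C * C' * M ^ k * expSum K (δ / 2), δ / 2, by positivity, by positivity, fun x y => ?_⟩
  have hx := inv_pos.mpr (fluxDist_pos x.1)
  have hbound : ∀ z : (ℤ × ℤ) × Fin K, ‖entry S x z * entry T z y‖ ≤
      C * C' * M ^ k * Real.exp (-(δ / 2) * ‖site x.1 - site y.1‖) * (fluxDist x.1)⁻¹ ^ (j + k) *
        Real.exp (-(δ / 2) * ‖site x.1 - site z.1‖) := by
    intro z
    set a := ‖site x.1 - site z.1‖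
    set b := ‖site z.1 - site y.1‖
    set c := ‖site x.1 - site y.1‖
    have ha : 0 ≤ a := norm_nonneg _
    have hb : 0 ≤ b := norm_nonneg _
    have habc : c ≤ a + b := norm_sub_le_norm_sub_add_norm_sub _ _ _
    have hz := inv_pos.mpr (fluxDist_pos z.1)
    have h1 : (fluxDist z.1)⁻¹ ^ k ≤ M ^ k * Real.exp (γ / 2 * a) * (fluxDist x.1)⁻¹ ^ k := by
      calc (fluxDist z.1)⁻¹ ^ k ≤ (M * Real.exp (ε * a) * (fluxDist x.1)⁻¹) ^ k := by
            gcongr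
            exact inv_fluxDist_le hε _ _
        _ = M ^ k * Real.exp (k * ε * a) * (fluxDist x.1)⁻¹ ^ k := by
            rw [mul_pow, mul_pow, ← Real.exp_nat_mul, mul_assoc (k : ℝ)]
        _ ≤ _ := by gcongr
    rw [norm_mul]
    calc ‖entry S x z‖ * ‖entry T z y‖
        ≤ (C * Real.exp (-γ * a) * (fluxDist x.1)⁻¹ ^ j) *
          (C' * Real.exp (-γ' * b) * (M ^ k * Real.exp (γ / 2 * a) * (fluxDist x.1)⁻¹ ^ k)) := by
          refine mul_le_mul (h x z) ((h' z y).trans ?_) (norm_nonneg _) (by positivity)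
          gcongr
      _ = C * C' * M ^ k * (fluxDist x.1)⁻¹ ^ (j + k) *
          Real.exp (-γ * a + (-γ' * b + γ / 2 * a)) := by
          rw [pow_add, Real.exp_add, Real.exp_add]
          ring
      _ ≤ C * C' * M ^ k * (fluxDist x.1)⁻¹ ^ (j + k) *
          Real.exp (-(δ / 2) * c + -(δ / 2) * a) := by
          refine mul_le_mul_of_nonneg_left (Real.exp_le_exp.mpr ?_) (by positivity)
          have e1 := mul_le_mul_of_nonneg_right hδ1 ha
          have e2 := mul_le_mul_of_nonneg_right hδ2 hb
          have e3 := mul_le_mul_of_nonneg_left habc hδ.le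
          have e4 := mul_nonneg hδ.le hb
          linarith
      _ = _ := by
          rw [Real.exp_add]
          ring
  have hsum := ((hasSum_exp_site_sub K (half_pos hδ) x.1).mul_left
    (C * C' * M ^ k * Real.exp (-(δ / 2) * ‖site x.1 - site y.1‖) * (fluxDist x.1)⁻¹ ^ (j + k)))
  rw [← (hasSum_entry_mul S T x y).tsum_eq]
  refine (tsum_of_norm_bounded hsum hbound).trans (le_of_eq ?_)
  ring

theorem Decays.zero_mul {k : ℕ} {S T : H K →L[ℂ] H K} (hS : Decays 0 S) (hT : Decays k T) :
    Decays k (S * T) := by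
  simpa using hS.mul hT

theorem Decays.mul_zero {k : ℕ} {S T : H K →L[ℂ] H K} (hS : Decays k S) (hT : Decays 0 T) :
    Decays k (S * T) := by
  simpa using hS.mul hT

theorem Decays.mono {j k : ℕ} (hjk : j ≤ k) {T : H K →L[ℂ] H K} (hT : Decays k T) :
    Decays j T := by
  obtain ⟨C, γ, hC, hγ, h⟩ := hT
  refine ⟨C * 2 ^ (k - j), γ, by positivity, hγ, fun x y => (h x y).trans ?_⟩
  have hx := inv_pos.mpr (fluxDist_pos x.1)
  have h2 : (fluxDist x.1)⁻¹ ≤ 2 := by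
    rw [inv_le_comm₀ (fluxDist_pos _) (by norm_num)]
    simpa using half_le_fluxDist x.1
  calc C * Real.exp (-γ * ‖site x.1 - site y.1‖) * (fluxDist x.1)⁻¹ ^ k
      = C * Real.exp (-γ * ‖site x.1 - site y.1‖) *
        ((fluxDist x.1)⁻¹ ^ j * (fluxDist x.1)⁻¹ ^ (k - j)) := by
        rw [← pow_add, Nat.add_sub_cancel' hjk]
    _ ≤ C * Real.exp (-γ * ‖site x.1 - site y.1‖) * ((fluxDist x.1)⁻¹ ^ j * 2 ^ (k - j)) := by
        gcongr
    _ = _ := by ring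

theorem summable_inv_fluxDist_pow_mul_exp (K : ℕ) {δ : ℝ} (hδ : 0 < δ) :
    Summable fun p : ((ℤ × ℤ) × Fin K) × ((ℤ × ℤ) × Fin K) =>
      Real.exp (-δ * ‖site p.1.1 - site p.2.1‖) * (fluxDist p.1.1)⁻¹ ^ 3 := by
  have hp : ∀ n, 0 ≤ (fluxDist n)⁻¹ ^ 3 := fun n => by
    have := fluxDist_pos n
    positivity
  have hs : Summable fun x : (ℤ × ℤ) × Fin K => expSum K δ * (fluxDist x.1)⁻¹ ^ 3 := by
    have := summable_inv_fluxDist_pow.mul_of_nonneg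
      (Summable.of_finite (f := fun _ : Fin K => (1 : ℝ))) hp (fun _ => zero_le_one)
    simp only [mul_one] at this
    exact this.mul_left _
  have hfib : ∀ x : (ℤ × ℤ) × Fin K, HasSum (fun y : (ℤ × ℤ) × Fin K =>
      Real.exp (-δ * ‖site x.1 - site y.1‖) * (fluxDist x.1)⁻¹ ^ 3)
      (expSum K δ * (fluxDist x.1)⁻¹ ^ 3) :=
    fun x => (hasSum_exp_site_sub K hδ x.1).mul_right _
  have hnn : 0 ≤ fun p : ((ℤ × ℤ) × Fin K) × ((ℤ × ℤ) × Fin K) =>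
      Real.exp (-δ * ‖site p.1.1 - site p.2.1‖) * (fluxDist p.1.1)⁻¹ ^ 3 :=
    fun p => mul_nonneg (Real.exp_pos _).le (hp _)
  refine (summable_prod_of_nonneg hnn).mpr ⟨fun x => (hfib x).summable, ?_⟩
  exact hs.congr fun x => (hfib x).tsum_eq.symm

theorem Decays.summableEntries {T : H K →L[ℂ] H K} (hT : Decays 3 T) : SummableEntries T := by
  obtain ⟨C, γ, hC, hγ, h⟩ := hT
  refine Summable.of_nonneg_of_le (fun _ => norm_nonneg _) (fun p => h p.1 p.2) ?_
  simp only [mul_assoc]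
  exact (summable_inv_fluxDist_pow_mul_exp K hγ).mul_left C

end

section

/-! ### The Fredholm index on a Hilbert space -/

section Fredholm

open ContinuousLinearMap

variable {E : Type*} [NormedAddCommGroup E] [InnerProductSpace ℂ E]

theorem clm_mul_apply (S T : E →L[ℂ] E) (x : E) : (S * T) x = S (T x) := rfl

theorem clm_one_apply (x : E) : (1 : E →L[ℂ] E) x = x := rfl

variable [CompleteSpace E]

theorem finrank_quotient_range {F : E →L[ℂ] E} (hF : F.IsFredholm) :
    Module.finrank ℂ (E ⧸ F.range) = Module.finrank ℂ (adjoint F).ker := by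
  have hc : CompleteSpace F.range := hF.isClosed_range.completeSpace_coe
  rw [← F.orthogonal_range]
  exact (Submodule.quotientEquivOfIsCompl F.range F.rangeᗮ
    (Submodule.isTopCompl_orthogonal _).isCompl).finrank_eq

theorem finiteDimensional_ker_adjoint {F : E →L[ℂ] E} (hF : F.IsFredholm) :
    FiniteDimensional ℂ (adjoint F).ker := by
  have hc : CompleteSpace F.range := hF.isClosed_range.completeSpace_coe
  rw [← F.orthogonal_range]
  have := hF.finite_coker
  exact Module.Finite.equiv (Submodule.quotientEquivOfIsCompl F.range F.rangeᗮ
    (Submodule.isTopCompl_orthogonal _).isCompl)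

/-- A Fredholm operator has a Moore–Penrose inverse: a quasi-inverse whose defects are the
orthogonal projections onto `ker F` and `ker F*`. -/
theorem exists_moorePenrose {F : E →L[ℂ] E} (hF : F.IsFredholm)
    [FiniteDimensional ℂ F.ker] [FiniteDimensional ℂ (adjoint F).ker] :
    ∃ G : E →L[ℂ] E, G * F = 1 - F.ker.starProjection ∧
      F * G = 1 - (adjoint F).ker.starProjection ∧
      F.ker.starProjection * G = 0 ∧ G * (adjoint F).ker.starProjection = 0 := by
  have hc : CompleteSpace F.range := hF.isClosed_range.completeSpace_coe
  set pkg := hF.fredholmPackage (Submodule.isTopCompl_orthogonal F.ker)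
    (Submodule.isTopCompl_orthogonal F.range) with hpkg
  have hX1 : pkg.decDom.X₁ = F.kerᗮ := rfl
  have hX0 : pkg.decDom.X₀ = F.ker := rfl
  have hY1 : pkg.decCodom.X₁ = F.range := rfl
  have hGF : pkg.quasiInverse * F = 1 - F.ker.starProjection := by
    ext x
    have e : F x = pkg.decCodom.X₁.subtypeL (pkg.equiv (pkg.decDom.proj x)) :=
      congrArg (fun T : E →L[ℂ] E => T x) pkg.eq_equiv
    have e2 : (pkg.quasiInverse * F) x = (pkg.decDom.proj x : E) := by
      rw [clm_mul_apply, e]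
      simp [FredholmPackage.quasiInverse]
    rw [e2]
    have hx := F.ker.starProjection_add_starProjection_orthogonal x
    have h0 : pkg.decDom.proj (F.ker.starProjection x) = 0 := by
      rw [Submodule.projectionOntoL_apply_eq_zero_iff]
      change _ ∈ F.ker
      exact Submodule.starProjection_apply_mem _ _
    have hm : F.kerᗮ.starProjection x ∈ pkg.decDom.X₁ := by
      rw [hX1]
      exact Submodule.starProjection_apply_mem _ _
    have h1 : (pkg.decDom.proj (F.kerᗮ.starProjection x) : E) = F.kerᗮ.starProjection x := by
      exact congrArg Subtype.val (Submodule.projectionOntoL_apply_left pkg.decDom.isTopCompl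
        ⟨F.kerᗮ.starProjection x, hm⟩)
    nth_rewrite 1 [← hx]
    rw [map_add, h0, zero_add, h1, sub_apply, clm_one_apply, eq_sub_iff_add_eq, add_comm]
    exact hx
  have hFG : F * pkg.quasiInverse = 1 - (adjoint F).ker.starProjection := by
    ext y
    have e : ∀ x, F x = pkg.decCodom.X₁.subtypeL (pkg.equiv (pkg.decDom.proj x)) :=
      fun x => congrArg (fun T : E →L[ℂ] E => T x) pkg.eq_equiv
    have e2 : (F * pkg.quasiInverse) y = (pkg.decCodom.proj y : E) := by
      rw [clm_mul_apply, e]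
      simp [FredholmPackage.quasiInverse]
    rw [e2]
    have hr : F.rangeᗮ = (adjoint F).ker := F.orthogonal_range
    have hr' : (adjoint F).kerᗮ = F.range := by
      rw [← hr, Submodule.orthogonal_orthogonal]
    have hy := (adjoint F).ker.starProjection_add_starProjection_orthogonal y
    have h0 : pkg.decCodom.proj ((adjoint F).ker.starProjection y) = 0 := by
      rw [Submodule.projectionOntoL_apply_eq_zero_iff]
      change _ ∈ F.rangeᗮ
      rw [hr]
      exact Submodule.starProjection_apply_mem _ _
    have hm : (adjoint F).kerᗮ.starProjection y ∈ pkg.decCodom.X₁ := by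
      rw [hY1, ← hr']
      exact Submodule.starProjection_apply_mem _ _
    have h1 : (pkg.decCodom.proj ((adjoint F).kerᗮ.starProjection y) : E) =
        (adjoint F).kerᗮ.starProjection y :=
      congrArg Subtype.val (Submodule.projectionOntoL_apply_left pkg.decCodom.isTopCompl
        ⟨(adjoint F).kerᗮ.starProjection y, hm⟩)
    nth_rewrite 1 [← hy]
    rw [map_add, h0, zero_add, h1, sub_apply, clm_one_apply, eq_sub_iff_add_eq, add_comm]
    exact hy
  have h0G : F.ker.starProjection * pkg.quasiInverse = 0 := by
    ext y
    rw [clm_mul_apply, zero_apply, Submodule.starProjection_apply_eq_zero_iff]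
    exact (pkg.equiv.symm (pkg.decCodom.proj y)).2
  refine ⟨pkg.quasiInverse, hGF, hFG, h0G, ?_⟩
  have h := mul_assoc pkg.quasiInverse F pkg.quasiInverse
  rw [hGF, hFG, sub_mul, mul_sub, one_mul, mul_one, h0G, sub_zero] at h
  exact (sub_eq_self.mp h.symm)

/-- The Fredholm index is locally constant. If `G` is the Moore–Penrose inverse of `F`, with
`G F = 1 - A` and `F G = 1 - B`, then `S = 1 + G (F' - F)` is invertible for `F'` near `F`, and
`F' S⁻¹` maps `ker F` to `ker F*` with kernel and cokernel isomorphic to those of `F'`. -/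
theorem exists_index_eq_of_norm_sub_lt {F : E →L[ℂ] E} (hF : F.IsFredholm) :
    ∃ ε > 0, ∀ F' : E →L[ℂ] E, F'.IsFredholm → ‖F' - F‖ < ε → index F' = index F := by
  have hN := hF.finite_ker
  have hM := finiteDimensional_ker_adjoint hF
  obtain ⟨G, hGF, hFG, hAG, hGB⟩ := exists_moorePenrose hF
  refine ⟨(‖G‖ + 1)⁻¹, by positivity, fun F' hF' hlt => ?_⟩
  set A := F.ker.starProjection with hA
  set B := (adjoint F).ker.starProjection with hB
  have hsmall : ‖G‖ * ‖F' - F‖ < 1 := by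
    have h1 : ‖F' - F‖ * (‖G‖ + 1) < 1 := by
      rwa [← one_div, lt_div_iff₀ (by positivity)] at hlt
    nlinarith [norm_nonneg (F' - F)]
  obtain ⟨S, hS⟩ : ∃ S : (E →L[ℂ] E)ˣ, (S : E →L[ℂ] E) = 1 + G * (F' - F) := by
    have hn : ‖-(G * (F' - F))‖ < 1 := by
      rw [norm_neg]
      exact (norm_mul_le _ _).trans_lt hsmall
    exact ⟨Units.oneSub _ hn, by simp⟩
  obtain ⟨R, hR⟩ : ∃ R : (E →L[ℂ] E)ˣ, (R : E →L[ℂ] E) = 1 + (F' - F) * G := by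
    have hn : ‖-((F' - F) * G)‖ < 1 := by
      rw [norm_neg]
      exact (norm_mul_le _ _).trans_lt (by rwa [mul_comm])
    exact ⟨Units.oneSub _ hn, by simp⟩
  have hGF' : G * F' = S - A := by
    rw [hS, mul_sub, hGF]
    abel
  have hF'G : F' * G = R - B := by
    rw [hR, sub_mul, hFG]
    abel
  have hAS : A * (↑S⁻¹ : E →L[ℂ] E) = A := by
    rw [Units.mul_inv_eq_iff_eq_mul, hS, mul_add, ← mul_assoc, hAG, zero_mul, mul_one, add_zero]
  have hGF'S : G * (F' * (↑S⁻¹ : E →L[ℂ] E)) = 1 - A := by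
    rw [← mul_assoc, hGF', sub_mul, Units.mul_inv, hAS]
  have hmemM : ∀ y, y ∈ (adjoint F).ker ↔ G y = 0 := by
    intro y
    rw [← Submodule.starProjection_eq_self_iff]
    constructor
    · intro h
      rw [← h]
      exact congrArg (fun T : E →L[ℂ] E => T y) hGB
    · intro h
      have := congrArg (fun T : E →L[ℂ] E => T y) hFG
      simp only [clm_mul_apply, h, map_zero, sub_apply, clm_one_apply] at this
      exact (sub_eq_zero.mp this.symm).symm
  have hmemN : ∀ x, x ∈ F.ker ↔ A x = x := fun x => Submodule.starProjection_eq_self_iff.symm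
  have hSS : ∀ x, (S : E →L[ℂ] E) ((↑S⁻¹ : E →L[ℂ] E) x) = x := fun x =>
    congrArg (fun T : E →L[ℂ] E => T x) (Units.mul_inv S)
  have hSS' : ∀ x, (↑S⁻¹ : E →L[ℂ] E) ((S : E →L[ℂ] E) x) = x := fun x =>
    congrArg (fun T : E →L[ℂ] E => T x) (Units.inv_mul S)
  have hmaps : ∀ n : F.ker, (F' * (↑S⁻¹ : E →L[ℂ] E)) n ∈ (adjoint F).ker := by
    intro n
    rw [hmemM]
    have := congrArg (fun T : E →L[ℂ] E => T n) hGF'S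
    simp only [clm_mul_apply, sub_apply, clm_one_apply, (hmemN n).mp n.2, sub_self] at this
    exact this
  set φ : F.ker →ₗ[ℂ] (adjoint F).ker :=
    ((F' * (↑S⁻¹ : E →L[ℂ] E) : E →L[ℂ] E) : E →ₗ[ℂ] E).restrict (p := F.ker)
      (fun n hn => hmaps ⟨n, hn⟩) with hφ
  have hφ_apply : ∀ n : F.ker, (φ n : E) = F' ((↑S⁻¹ : E →L[ℂ] E) n) := fun n => rfl
  -- a solution of `F' x ∈ ker F*` is of the form `S⁻¹ n` with `n ∈ ker F`
  have hform : ∀ x, F' x ∈ (adjoint F).ker → (S : E →L[ℂ] E) x ∈ F.ker := by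
    intro x hx
    rw [hmemM] at hx
    have h1 : G (F' x) = (S : E →L[ℂ] E) x - A x :=
      congrArg (fun T : E →L[ℂ] E => T x) hGF'
    rw [hx] at h1
    rw [sub_eq_zero.mp h1.symm]
    exact Submodule.starProjection_apply_mem _ _
  have hker : Module.finrank ℂ (LinearMap.ker φ) = Module.finrank ℂ F'.ker := by
    refine LinearEquiv.finrank_eq (LinearEquiv.ofBijective
      (((↑S⁻¹ : E →L[ℂ] E) : E →ₗ[ℂ] E).comp (F.ker.subtype.comp (LinearMap.ker φ).subtype)
        |>.codRestrict F'.ker fun n => ?_) ⟨?_, ?_⟩)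
    · have := n.2
      rw [LinearMap.mem_ker] at this ⊢
      have := congrArg Subtype.val this
      exact this
    · intro n m h
      have h1 : (↑S⁻¹ : E →L[ℂ] E) (n : F.ker) = (↑S⁻¹ : E →L[ℂ] E) (m : F.ker) :=
        congrArg Subtype.val h
      have h2 := congrArg (S : E →L[ℂ] E) h1
      rw [hSS, hSS] at h2
      exact Subtype.ext (Subtype.ext h2)
    · rintro ⟨x, hx⟩
      have hx0 : F' x = 0 := hx
      have hSx : (S : E →L[ℂ] E) x ∈ F.ker := hform x (by rw [hx0]; exact Submodule.zero_mem _)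
      refine ⟨⟨⟨(S : E →L[ℂ] E) x, hSx⟩, ?_⟩, ?_⟩
      · rw [LinearMap.mem_ker]
        refine Subtype.ext ?_
        rw [hφ_apply]
        simp [hSS', hx0]
      · exact Subtype.ext (hSS' x)
  set ψ : (adjoint F).ker →ₗ[ℂ] E ⧸ F'.range := F'.range.mkQ ∘ₗ (adjoint F).ker.subtype with hψ
  have hψsurj : LinearMap.range ψ = ⊤ := by
    rw [LinearMap.range_eq_top]
    intro q
    obtain ⟨h, rfl⟩ := Submodule.Quotient.mk_surjective _ q
    refine ⟨⟨B ((↑R⁻¹ : E →L[ℂ] E) h), Submodule.starProjection_apply_mem _ _⟩, ?_⟩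
    rw [hψ, LinearMap.comp_apply, Submodule.mkQ_apply, Submodule.Quotient.eq]
    have h1 : (F' * G * (↑R⁻¹ : E →L[ℂ] E)) h = h - B ((↑R⁻¹ : E →L[ℂ] E) h) := by
      rw [hF'G, sub_mul, Units.mul_inv]
      rfl
    refine ⟨-(G ((↑R⁻¹ : E →L[ℂ] E) h)), ?_⟩
    have h2 : F' (G ((↑R⁻¹ : E →L[ℂ] E) h)) = h - B ((↑R⁻¹ : E →L[ℂ] E) h) := h1
    simp [h2]
  have hψker : LinearMap.ker ψ = LinearMap.range φ := by
    ext m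
    rw [LinearMap.mem_ker, hψ, LinearMap.comp_apply, Submodule.mkQ_apply,
      Submodule.Quotient.mk_eq_zero]
    constructor
    · rintro ⟨x, hx⟩
      have hx' : F' x = m := hx
      refine ⟨⟨(S : E →L[ℂ] E) x, hform x (by rw [hx']; exact m.2)⟩, ?_⟩
      refine Subtype.ext ?_
      rw [hφ_apply]
      simp [hSS', hx']
    · rintro ⟨n, rfl⟩
      exact ⟨(↑S⁻¹ : E →L[ℂ] E) n, rfl⟩
  -- rank-nullity for `φ` and for the quotient map `ψ`, whose kernel is the range of `φ`
  have r1 := LinearMap.finrank_range_add_finrank_ker φ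
  have r2 := LinearMap.finrank_range_add_finrank_ker ψ
  rw [hψsurj, finrank_top, hψker, finrank_quotient_range hF'] at r2
  rw [hker] at r1
  unfold index
  omega

end Fredholm

end

section

/-! ### The index as a difference of diagonal sums -/

section Fedosov

open ContinuousLinearMap

open scoped LinearMap.FiniteRangeSetoid in
/-- An operator with a left and a right inverse modulo finite rank is Fredholm. -/
theorem isFredholm_of_left_right {E : Type*} [NormedAddCommGroup E] [InnerProductSpace ℂ E]
    {F L R X Y : E →L[ℂ] E} (hL : L * F = 1 - X) (hR : F * R = 1 - Y)
    (hX : (X : E →ₗ[ℂ] E).HasFiniteRange) (hY : (Y : E →ₗ[ℂ] E).HasFiniteRange) :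
    F.IsFredholm := by
  have h1 : (L : E →ₗ[ℂ] E) ∘ₗ (F : E →ₗ[ℂ] E) ≈ .id := by
    rw [LinearMap.FiniteRangeSetoid.equiv_iff_hasFiniteRange]
    have : (L : E →ₗ[ℂ] E) ∘ₗ (F : E →ₗ[ℂ] E) - .id = -(X : E →ₗ[ℂ] E) := by
      ext x
      have := congrArg (fun T : E →L[ℂ] E => T x) hL
      simp only [clm_mul_apply, sub_apply, clm_one_apply] at this
      simp [this]
    rw [this]
    exact hX.neg
  have h2 : (F : E →ₗ[ℂ] E) ∘ₗ (R : E →ₗ[ℂ] E) ≈ .id := by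
    rw [LinearMap.FiniteRangeSetoid.equiv_iff_hasFiniteRange]
    have : (F : E →ₗ[ℂ] E) ∘ₗ (R : E →ₗ[ℂ] E) - .id = -(Y : E →ₗ[ℂ] E) := by
      ext x
      have := congrArg (fun T : E →L[ℂ] E => T x) hR
      simp only [clm_mul_apply, sub_apply, clm_one_apply] at this
      simp [this]
    rw [this]
    exact hY.neg
  refine IsFredholm.of_isQuasiInverse (v := L) ⟨h1, ?_⟩
  calc (F : E →ₗ[ℂ] E) ∘ₗ (L : E →ₗ[ℂ] E) = ((F : E →ₗ[ℂ] E) ∘ₗ (L : E →ₗ[ℂ] E)) ∘ₗ .id := rfl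
    _ ≈ ((F : E →ₗ[ℂ] E) ∘ₗ (L : E →ₗ[ℂ] E)) ∘ₗ ((F : E →ₗ[ℂ] E) ∘ₗ (R : E →ₗ[ℂ] E)) := by
        grw [h2]
    _ = (F : E →ₗ[ℂ] E) ∘ₗ ((L : E →ₗ[ℂ] E) ∘ₗ (F : E →ₗ[ℂ] E)) ∘ₗ (R : E →ₗ[ℂ] E) := rfl
    _ ≈ (F : E →ₗ[ℂ] E) ∘ₗ .id ∘ₗ (R : E →ₗ[ℂ] E) := by grw [h1]
    _ ≈ .id := h2

variable {ι : Type*} [DecidableEq ι]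

/-- `F` is Fredholm as soon as the squares of `1 - F*F` and `1 - FF*` are trace class in the sense
of `SummableEntries`. -/
theorem isFredholm_of_summableEntries {F : Ell2 ι →L[ℂ] Ell2 ι}
    (hA : SummableEntries ((1 - star F * F) * (1 - star F * F)))
    (hB : SummableEntries ((1 - F * star F) * (1 - F * star F))) : F.IsFredholm := by
  obtain ⟨X, hX, hXn⟩ := hA.exists_finiteRange_norm_sub_lt one_pos
  obtain ⟨Y, hY, hYn⟩ := hB.exists_finiteRange_norm_sub_lt one_pos
  set A := 1 - star F * F with hAdef
  set B := 1 - F * star F with hBdef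
  have hV : ((Units.oneSub _ hXn : (Ell2 ι →L[ℂ] Ell2 ι)ˣ) : Ell2 ι →L[ℂ] Ell2 ι) =
    1 - (A * A - X) := rfl
  have hW : ((Units.oneSub _ hYn : (Ell2 ι →L[ℂ] Ell2 ι)ˣ) : Ell2 ι →L[ℂ] Ell2 ι) =
    1 - (B * B - Y) := rfl
  set V := Units.oneSub _ hXn
  set W := Units.oneSub _ hYn
  -- `(1 + A) F* F = 1 - A²`, and `1 - A²` is invertible up to the finite-rank operator `X`
  have hL : ((↑V⁻¹ : Ell2 ι →L[ℂ] Ell2 ι) * (1 + A) * star F) * F = 1 - ↑V⁻¹ * X := by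
    have h1 : (1 + A) * (star F * F) = V - X := by
      have : star F * F = 1 - A := by rw [hAdef]; abel
      rw [this, hV]
      noncomm_ring
    rw [mul_assoc, mul_assoc, h1, mul_sub, Units.inv_mul]
  have hR : F * (star F * (1 + B) * (↑W⁻¹ : Ell2 ι →L[ℂ] Ell2 ι)) = 1 - Y * ↑W⁻¹ := by
    have h1 : (F * star F) * (1 + B) = W - Y := by
      have : F * star F = 1 - B := by rw [hBdef]; abel
      rw [this, hW]
      noncomm_ring
    rw [← mul_assoc, ← mul_assoc, h1, sub_mul, Units.mul_inv]
  exact isFredholm_of_left_right hL hR (hX.comp_left _) (hY.comp_right _)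

/-- Fedosov's formula `Ind F = Tr (1 - F*F)² - Tr (1 - FF*)²`. With `A = 1 - F*F`, `B = 1 - FF*` and
the Moore–Penrose inverse `G`, both `A² - [ker F] = G (B²F)` and `B² - [ker F*] = (B²F) G`, and
these have the same trace. -/
theorem index_eq_diagSum {F : Ell2 ι →L[ℂ] Ell2 ι}
    (hA : SummableEntries ((1 - star F * F) * (1 - star F * F)))
    (hB : SummableEntries ((1 - F * star F) * (1 - F * star F)))
    (hBF : SummableEntries ((1 - F * star F) * (1 - F * star F) * F)) :
    (index F : ℂ) = diagSum ((1 - star F * F) * (1 - star F * F)) -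
      diagSum ((1 - F * star F) * (1 - F * star F)) := by
  have hF := isFredholm_of_summableEntries hA hB
  have hN := hF.finite_ker
  have hM := finiteDimensional_ker_adjoint hF
  obtain ⟨G, hGF, hFG, -, -⟩ := exists_moorePenrose hF
  have hA0 := hasSum_entry_starProjection F.ker
  have hB0 := hasSum_entry_starProjection (adjoint F).ker
  set A0 := F.ker.starProjection
  set B0 := (adjoint F).ker.starProjection
  have hFA0 : F * A0 = 0 := by
    ext1 x
    exact Submodule.starProjection_apply_mem F.ker x
  have hFB0 : star F * B0 = 0 := by
    ext1 x
    exact Submodule.starProjection_apply_mem (adjoint F).ker x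
  have hsA0 : star A0 = A0 := (isStarProjection_starProjection (U := F.ker)).isSelfAdjoint
  have hA0F : A0 * star F = 0 := by
    have := congrArg star hFA0
    rwa [star_mul, star_zero, hsA0] at this
  set A := 1 - star F * F with hAdef
  set B := 1 - F * star F with hBdef
  have hFA : F * A = B * F := by rw [hAdef, hBdef]; noncomm_ring
  clear_value A B
  have hA0A : A0 * (A * A) = A0 := by
    have : A0 * A = A0 := by rw [hAdef, mul_sub, mul_one, ← mul_assoc, hA0F, zero_mul, sub_zero]
    rw [← mul_assoc, this, this]
  have hBB0 : B * B * B0 = B0 := by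
    have : B * B0 = B0 := by rw [hBdef, sub_mul, one_mul, mul_assoc, hFB0, mul_zero, sub_zero]
    rw [mul_assoc, this, this]
  have h1 : A * A - A0 = G * (B * B * F) := by
    have : B * B * F = F * (A * A) := by rw [mul_assoc, ← hFA, ← mul_assoc, ← hFA, mul_assoc]
    rw [this, ← mul_assoc, hGF, sub_mul, one_mul, hA0A]
  have h2 : B * B - B0 = B * B * F * G := by
    rw [mul_assoc (B * B), hFG, mul_sub, mul_one, hBB0]
  have h3 := hBF.diagSum_mul_comm G
  rw [← h1, ← h2, diagSum_sub hA.summable_diag hA0.summable,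
    diagSum_sub hB.summable_diag hB0.summable] at h3
  have e1 : diagSum A0 = (Module.finrank ℂ F.ker : ℂ) := hA0.tsum_eq
  have e2 : diagSum B0 = (Module.finrank ℂ (adjoint F).ker : ℂ) := hB0.tsum_eq
  rw [e1, e2] at h3
  unfold index
  push_cast
  linear_combination -h3

end Fedosov

/-! ### The flux operator -/

variable {K : ℕ}

/-- The flux insertion as a bounded operator. -/
def fluxOp (K : ℕ) : H K →L[ℂ] H K := (flux K : H K →L[ℂ] H K)

theorem star_fluxOp_mul_self : star (fluxOp K) * fluxOp K = 1 := by
  have h : star (fluxOp K) = ((flux K).symm : H K →L[ℂ] H K) := (flux K).adjoint_eq_symm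
  rw [h]
  ext1 ψ
  exact (flux K).symm_apply_apply ψ

theorem fluxOp_mul_star_self : fluxOp K * star (fluxOp K) = 1 := by
  have h : star (fluxOp K) = ((flux K).symm : H K →L[ℂ] H K) := (flux K).adjoint_eq_symm
  rw [h]
  ext1 ψ
  exact (flux K).apply_symm_apply ψ

theorem entry_fluxOp (x y : (ℤ × ℤ) × Fin K) :
    entry (fluxOp K) x y = if x = y then phase y.1 else 0 := by
  change flux K (lp.single 2 y (1 : ℂ)) x = _
  rw [flux_apply, lp.coeFn_single, Pi.single_apply]
  by_cases h : x = y <;> simp [h]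

theorem entry_star_fluxOp (x y : (ℤ × ℤ) × Fin K) :
    entry (star (fluxOp K)) x y = if x = y then star (phase y.1) else 0 := by
  rw [ContinuousLinearMap.star_eq_adjoint, entry_adjoint, entry_fluxOp]
  by_cases h : x = y
  · simp [h]
  · simp [h, Ne.symm h]

theorem entry_fluxOp_mul (T : H K →L[ℂ] H K) (x y : (ℤ × ℤ) × Fin K) :
    entry (fluxOp K * T) x y = phase x.1 * entry T x y := by
  refine (hasSum_entry_mul _ T x y).unique ?_
  convert hasSum_single x fun z hz => ?_ using 1
  · simp [entry_fluxOp]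
  · simp [entry_fluxOp, hz.symm]

theorem entry_mul_fluxOp (T : H K →L[ℂ] H K) (x y : (ℤ × ℤ) × Fin K) :
    entry (T * fluxOp K) x y = entry T x y * phase y.1 := by
  refine (hasSum_entry_mul T _ x y).unique ?_
  convert hasSum_single y fun z hz => ?_ using 1
  · simp [entry_fluxOp]
  · simp [entry_fluxOp, hz]

theorem entry_star_fluxOp_mul (T : H K →L[ℂ] H K) (x y : (ℤ × ℤ) × Fin K) :
    entry (star (fluxOp K) * T) x y = star (phase x.1) * entry T x y := by
  refine (hasSum_entry_mul _ T x y).unique ?_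
  convert hasSum_single x fun z hz => ?_ using 1
  · simp [entry_star_fluxOp]
  · simp [entry_star_fluxOp, hz.symm]

theorem entry_mul_star_fluxOp (T : H K →L[ℂ] H K) (x y : (ℤ × ℤ) × Fin K) :
    entry (T * star (fluxOp K)) x y = entry T x y * star (phase y.1) := by
  refine (hasSum_entry_mul T _ x y).unique ?_
  convert hasSum_single y fun z hz => ?_ using 1
  · simp [entry_star_fluxOp]
  · simp [entry_star_fluxOp, hz]

theorem phase_mul_star (n : ℤ × ℤ) : phase n * star (phase n) = 1 := by
  rw [← starRingEnd_apply, Complex.mul_conj', norm_phase]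
  norm_num

theorem norm_phase_sub_le (n m : ℤ × ℤ) :
    ‖phase n - phase m‖ ≤ 2 * ‖site n - site m‖ * (fluxDist n)⁻¹ := by
  have hn := fluxDist_pos n
  have hm := fluxDist_pos m
  set a := site n + fluxPoint with ha
  set b := site m + fluxPoint with hb
  have hab : site n - site m = a - b := by rw [ha, hb]; ring
  have hn' : (fluxDist n : ℂ) ≠ 0 := by exact_mod_cast hn.ne'
  have hm' : (fluxDist m : ℂ) ≠ 0 := by exact_mod_cast hm.ne'
  have e : phase n - phase m =
      ((a - b) + phase m * ((fluxDist m : ℂ) - fluxDist n)) * (fluxDist n : ℂ)⁻¹ := by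
    change a / (fluxDist n : ℂ) - b / (fluxDist m : ℂ) =
      ((a - b) + b / (fluxDist m : ℂ) * ((fluxDist m : ℂ) - fluxDist n)) * (fluxDist n : ℂ)⁻¹
    field_simp
    ring
  rw [e, norm_mul, hab, norm_inv, Complex.norm_real, Real.norm_of_nonneg hn.le]
  refine mul_le_mul_of_nonneg_right ?_ (inv_pos.mpr hn).le
  refine (norm_add_le _ _).trans ?_
  rw [norm_mul, norm_phase, one_mul, two_mul]
  refine add_le_add le_rfl ?_
  rw [← Complex.ofReal_sub, Complex.norm_real, Real.norm_eq_abs, norm_sub_rev]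
  exact abs_norm_sub_norm_le b a

theorem decays_zero_of_entry_eq_ite {T : H K →L[ℂ] H K} {f : (ℤ × ℤ) × Fin K → ℂ}
    (hf : ∀ x, ‖f x‖ ≤ 1) (h : ∀ x y, entry T x y = if x = y then f y else 0) : Decays 0 T := by
  refine ⟨1, 1, zero_le_one, one_pos, fun x y => ?_⟩
  rw [h]
  by_cases hxy : x = y
  · simpa [hxy] using hf y
  · simp only [hxy, if_false, norm_zero]
    positivity

theorem decays_one : Decays 0 (1 : H K →L[ℂ] H K) :=
  decays_zero_of_entry_eq_ite (f := fun _ => 1) (by simp) entry_one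

theorem decays_fluxOp : Decays 0 (fluxOp K) :=
  decays_zero_of_entry_eq_ite (f := fun x => phase x.1) (fun x => (norm_phase x.1).le) entry_fluxOp

/-- A phase difference in the matrix gains one power of decay along the diagonal, because the phase
is nearly constant far from the flux tube. -/
theorem Decays.of_norm_entry_le {T S : H K →L[ℂ] H K} (hT : Decays 0 T)
    (h : ∀ x y, ‖entry S x y‖ ≤ ‖entry T x y‖ * ‖phase x.1 - phase y.1‖) : Decays 1 S := by
  obtain ⟨C, γ, hC, hγ, hT⟩ := hT
  refine ⟨C * (4 / γ), γ / 2, by positivity, by positivity, fun x y => (h x y).trans ?_⟩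
  set d := ‖site x.1 - site y.1‖
  have hd : 0 ≤ d := norm_nonneg _
  have hx := inv_pos.mpr (fluxDist_pos x.1)
  have h1 : 2 * d ≤ 4 / γ * Real.exp (γ / 2 * d) := by
    have h2 := Real.add_one_le_exp (γ / 2 * d)
    have h3 : 4 / γ * (γ / 2 * d) = 2 * d := by
      field_simp
      ring
    rw [← h3]
    refine mul_le_mul_of_nonneg_left ?_ (by positivity)
    linarith
  calc ‖entry T x y‖ * ‖phase x.1 - phase y.1‖
      ≤ (C * Real.exp (-γ * d) * (fluxDist x.1)⁻¹ ^ 0) * (2 * d * (fluxDist x.1)⁻¹) :=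
        mul_le_mul (hT x y) (norm_phase_sub_le _ _) (norm_nonneg _) (by positivity)
    _ ≤ (C * Real.exp (-γ * d) * (fluxDist x.1)⁻¹ ^ 0) *
        (4 / γ * Real.exp (γ / 2 * d) * (fluxDist x.1)⁻¹) := by gcongr
    _ = C * (4 / γ) * Real.exp (-γ * d + γ / 2 * d) * (fluxDist x.1)⁻¹ ^ 1 := by
        rw [Real.exp_add]
        ring
    _ = _ := by
        congr 3
        ring

theorem Decays.commutator_fluxOp {T : H K →L[ℂ] H K} (hT : Decays 0 T) :
    Decays 1 (T * fluxOp K - fluxOp K * T) := by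
  refine hT.of_norm_entry_le fun x y => le_of_eq ?_
  rw [entry_sub, entry_mul_fluxOp, entry_fluxOp_mul, ← norm_mul, ← norm_neg]
  congr 1
  ring

theorem Decays.commutator_star_fluxOp {T : H K →L[ℂ] H K} (hT : Decays 0 T) :
    Decays 1 (T * star (fluxOp K) - star (fluxOp K) * T) := by
  refine hT.of_norm_entry_le fun x y => le_of_eq ?_
  rw [entry_sub, entry_mul_star_fluxOp, entry_star_fluxOp_mul, ← norm_star (phase x.1 - phase y.1),
    ← norm_mul, ← norm_neg, star_sub]
  congr 1
  ring

theorem IsLocalizedProjector.decays {P : H K →L[ℂ] H K} (hP : IsLocalizedProjector P) :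
    Decays 0 P := by
  obtain ⟨C, γ, hγ, h⟩ := hP.exp_decay
  refine ⟨|C|, γ, abs_nonneg _, hγ, fun x y => ?_⟩
  rw [entry_eq_inner, pow_zero, mul_one]
  exact (h x.1 y.1 x.2 y.2).le.trans
    (mul_le_mul_of_nonneg_right (le_abs_self C) (Real.exp_pos _).le)

end

section

/-! ### The index as the trace of the cube of a difference of projections -/

variable {K : ℕ}

theorem fluxCompression_eq (P : H K →L[ℂ] H K) :
    fluxCompression P = P * fluxOp K * P + (1 - P) := rfl

section Algebra

variable {R : Type*} [Ring R] {P U V : R}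

/-- With `F = PUP + 1 - P` and `F* = PVP + 1 - P`, the defect `1 - FF*` is quadratic in
commutators. -/
theorem one_sub_mul_compression (hP : P * P = P) (hUV : U * V = 1) :
    1 - (P * U * P + (1 - P)) * (P * V * P + (1 - P)) =
      -((P * U - U * P) * (1 - P) * (P * V - V * P)) := by
  have hP' : ∀ X, P * (P * X) = P * X := fun X => by rw [← mul_assoc, hP]
  have hUV' : ∀ X, U * (V * X) = X := fun X => by rw [← mul_assoc, hUV, one_mul]
  simp only [mul_sub, sub_mul, mul_add, add_mul, mul_assoc, hP, hP', hUV', mul_one, one_mul]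
  abel

theorem one_sub_mul_compression_mul (hP : P * P = P) :
    (1 - (P * U * P + (1 - P)) * (P * V * P + (1 - P))) * P =
      1 - (P * U * P + (1 - P)) * (P * V * P + (1 - P)) := by
  have hP' : ∀ X, P * (P * X) = P * X := fun X => by rw [← mul_assoc, hP]
  simp only [mul_sub, sub_mul, mul_add, add_mul, mul_assoc, hP, hP', mul_one, one_mul]
  abel

/-- The cube of `P - Q` with `Q = UPV` is the difference of the two defects, one of them conjugated
by the unitary `U`. -/
theorem sub_conj_pow_three (hP : P * P = P) (hUV : U * V = 1) (hVU : V * U = 1) :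
    (P - U * P * V) ^ 3 = (1 - (P * U * P + (1 - P)) * (P * V * P + (1 - P))) -
      U * (1 - (P * V * P + (1 - P)) * (P * U * P + (1 - P))) * V := by
  have hP' : ∀ X, P * (P * X) = P * X := fun X => by rw [← mul_assoc, hP]
  have hVU' : ∀ X, V * (U * X) = X := fun X => by rw [← mul_assoc, hVU, one_mul]
  simp only [pow_three, mul_sub, sub_mul, mul_add, add_mul, mul_assoc, hP, hP', hUV, hVU',
    mul_one, one_mul]
  abel

/-- The defects `A = 1 - F*F`, `B = 1 - FF*` and their squares differ by the commutator of `F*` with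
`X = BF`, which is written as a commutator with the unitary `V` and terms that contain the
commutator of `P` with `V`. -/
theorem defect_sub_defect (hP : P * P = P) {F G A B X : R}
    (hF : F = P * U * P + (1 - P)) (hG : G = P * V * P + (1 - P)) (hA : A = 1 - G * F)
    (hB : B = 1 - F * G) (hX : X = B * F) :
    A - B = A * A - B * B + (V * X - X * V) + ((P * V - V * P) * X + X * (P * V - V * P)) := by
  have hP' : ∀ X, P * (P * X) = P * X := fun X => by rw [← mul_assoc, hP]
  subst hX hA hB hF hG
  simp only [mul_sub, sub_mul, mul_add, add_mul, mul_assoc, hP, hP', mul_one, one_mul]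
  abel

end Algebra

variable {P : H K →L[ℂ] H K}

theorem star_fluxCompression (hP : star P = P) :
    star (fluxCompression P) = P * star (fluxOp K) * P + (1 - P) := by
  rw [fluxCompression_eq]
  simp [hP, mul_assoc]

theorem decays_fluxCompression (hd : Decays 0 P) : Decays 0 (fluxCompression P) := by
  rw [fluxCompression_eq]
  exact ((hd.zero_mul decays_fluxOp).zero_mul hd).add (decays_one.sub hd)

theorem IsLocalizedProjector.mul_self (hP : IsLocalizedProjector P) : P * P = P :=
  hP.isStarProjection.isIdempotentElem

theorem IsLocalizedProjector.star_eq (hP : IsLocalizedProjector P) : star P = P :=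
  hP.isStarProjection.isSelfAdjoint

theorem IsLocalizedProjector.decays_defect (hP : IsLocalizedProjector P) :
    Decays 2 (1 - fluxCompression P * star (fluxCompression P)) := by
  rw [star_fluxCompression hP.star_eq, fluxCompression_eq,
    one_sub_mul_compression hP.mul_self fluxOp_mul_star_self]
  exact ((hP.decays.commutator_fluxOp.mul_zero (decays_one.sub hP.decays)).mul
    hP.decays.commutator_star_fluxOp).neg

theorem IsLocalizedProjector.decays_defect_star (hP : IsLocalizedProjector P) :
    Decays 2 (1 - star (fluxCompression P) * fluxCompression P) := by
  rw [star_fluxCompression hP.star_eq, fluxCompression_eq,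
    one_sub_mul_compression hP.mul_self star_fluxOp_mul_self]
  exact ((hP.decays.commutator_star_fluxOp.mul_zero (decays_one.sub hP.decays)).mul
    hP.decays.commutator_fluxOp).neg

theorem IsLocalizedProjector.isFredholm (hP : IsLocalizedProjector P) :
    (fluxCompression P).IsFredholm :=
  isFredholm_of_summableEntries
    ((hP.decays_defect_star.mul hP.decays_defect_star).mono (by norm_num)).summableEntries
    ((hP.decays_defect.mul hP.decays_defect).mono (by norm_num)).summableEntries

/-- `Ind F = -Tr (P - Q)³` with `Q = u P u*`. The exponent is lowered from the value that Fedosov's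
formula requires because the traces of `[P, u*] X` and `X [P, u*]` vanish when `X = PXP`: the
compression of `[P, u*]` to the range of `P` is zero. -/
theorem IsLocalizedProjector.hasSum_diag_pow_three (hP : IsLocalizedProjector P) :
    HasSum (fun x => entry ((P - fluxOp K * P * star (fluxOp K)) ^ 3) x x)
      (-(index (fluxCompression P) : ℂ)) := by
  set U := fluxOp K with hU
  set F := fluxCompression P with hF
  have hFe : F = P * U * P + (1 - P) := rfl
  have hGe : star F = P * star U * P + (1 - P) := star_fluxCompression hP.star_eq
  have hAd := hP.decays_defect_star
  have hBd := hP.decays_defect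
  have hFd : Decays 0 F := decays_fluxCompression hP.decays
  have hDd := hP.decays.commutator_star_fluxOp
  rw [← hF] at hAd hBd
  rw [← hU] at hDd
  have hPP := hP.mul_self
  have hUV : U * star U = 1 := fluxOp_mul_star_self
  have hVU : star U * U = 1 := star_fluxOp_mul_self
  set A := 1 - star F * F with hA
  set B := 1 - F * star F with hB
  set D := P * star U - star U * P with hD
  have hXd : Decays 2 (B * F) := hBd.mul_zero hFd
  have hAA : SummableEntries (A * A) := ((hAd.mul hAd).mono (by norm_num)).summableEntries
  have hBB : SummableEntries (B * B) := ((hBd.mul hBd).mono (by norm_num)).summableEntries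
  have hBBF : SummableEntries (B * B * F) :=
    (((hBd.mul hBd).mul_zero hFd).mono (by norm_num)).summableEntries
  have hDX : SummableEntries (D * (B * F)) := (hDd.mul hXd).summableEntries
  have hXD : SummableEntries (B * F * D) := (hXd.mul hDd).summableEntries
  have hind := index_eq_diagSum hAA hBB hBBF
  have hBs : star B = B := by simp [hB]
  rw [← hA, ← hB] at hind
  clear_value A B D
  have hBP : B * P = B := by
    rw [hB, hGe, hFe]
    exact one_sub_mul_compression_mul hPP
  have hPB : P * B = B := by
    have := congrArg star hBP
    rwa [star_mul, hBs, hP.star_eq] at this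
  have hXP : B * F * P = B * F := by
    have h1 : F * P = P * F := by
      rw [hFe]
      simp only [mul_sub, sub_mul, mul_add, add_mul, ← mul_assoc, hPP, mul_one, one_mul]
      simp only [mul_assoc, hPP]
    rw [mul_assoc, h1, ← mul_assoc, hBP]
  have hPDP : P * D * P = 0 := by
    rw [hD]
    simp only [mul_sub, sub_mul, ← mul_assoc, hPP]
    simp only [mul_assoc, hPP, sub_self]
  have htDX : diagSum (D * (B * F)) = 0 := by
    have h1 : D * (B * F) = D * (B * F) * P := by rw [mul_assoc, hXP]
    have h2 : P * (D * (B * F)) = 0 := by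
      rw [← hPB, mul_assoc P, ← mul_assoc, ← mul_assoc, hPDP, zero_mul]
    rw [h1, ← hDX.diagSum_mul_comm, h2]
    simp [diagSum, entry]
  have htXD : diagSum (B * F * D) = 0 := by
    have h1 : B * F * D = P * (B * F * D) := by rw [← mul_assoc, ← mul_assoc, hPB]
    have h2 : B * F * D * P = 0 := by
      rw [← hXP, mul_assoc, mul_assoc, ← mul_assoc P, hPDP, mul_zero]
    rw [h1, hXD.diagSum_mul_comm, h2]
    simp [diagSum, entry]
  -- the commutator with `V = u*` drops out because its diagonal vanishes
  have hsum : HasSum (fun x => entry (A - B) x x) (index F : ℂ) := by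
    have h1 := ((hAA.summable_diag.hasSum.sub hBB.summable_diag.hasSum).add
      (hDX.summable_diag.hasSum.add hXD.summable_diag.hasSum))
    change HasSum _ ((diagSum (A * A) - diagSum (B * B)) +
      (diagSum (D * (B * F)) + diagSum (B * F * D))) at h1
    rw [← hind, htDX, htXD, add_zero, add_zero] at h1
    refine h1.congr_fun fun x => ?_
    rw [defect_sub_defect hPP hFe hGe hA hB rfl, ← hD]
    simp only [entry_add, entry_sub]
    rw [hU, entry_star_fluxOp_mul, entry_mul_star_fluxOp]
    ring
  refine hsum.neg.congr_fun fun x => ?_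
  rw [sub_conj_pow_three hPP hUV hVU, ← hFe, ← hGe, ← hA, ← hB, entry_sub, entry_sub, hU,
    entry_mul_star_fluxOp, entry_fluxOp_mul]
  linear_combination -(entry A x x) * phase_mul_star x.1

end

section

/-! ### The area formula for the phase -/

/-- The sine of the oriented angle from `m` to `n`, seen from the flux tube. -/
def sinAngle (n m : ℤ × ℤ) : ℝ := (phase n * star (phase m)).im

/-- The sum of the sines of the oriented angles under which the sides of a triangle are seen from
the flux tube. -/
def sinTriangle (x y z : ℤ × ℤ) : ℝ := sinAngle x y + sinAngle y z + sinAngle z x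

theorem sinAngle_swap (n m : ℤ × ℤ) : sinAngle m n = -sinAngle n m := by
  simp only [sinAngle, Complex.mul_im, Complex.star_def, Complex.conj_re, Complex.conj_im]
  ring

theorem star_mul_phase (n : ℤ × ℤ) : star (phase n) * phase n = 1 := by
  rw [mul_comm, phase_mul_star]

/-- The product that occurs in the trace of `(P - Q)³` is, up to a factor, the coboundary
`sinTriangle` of `sinAngle`. This additive form is what makes its sum over translates a cocycle. -/
theorem one_sub_phase_mul (x y z : ℤ × ℤ) :
    (1 - phase x * star (phase y)) * (1 - phase y * star (phase z)) *
      (1 - phase z * star (phase x)) = -2 * Complex.I * sinTriangle x y z := by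
  have him : ∀ w : ℂ, (2 * Complex.I * (w.im : ℂ)) = w - star w := by
    intro w
    rw [Complex.star_def, Complex.sub_conj]
    push_cast
    ring
  have h1 := him (phase x * star (phase y))
  have h2 := him (phase y * star (phase z))
  have h3 := him (phase z * star (phase x))
  simp only [star_mul, star_star] at h1 h2 h3
  unfold sinTriangle sinAngle
  push_cast
  have hx := phase_mul_star x
  have hy := phase_mul_star y
  have hz := phase_mul_star z
  generalize phase x = a at *
  generalize phase y = b at *
  generalize phase z = c at *
  generalize star a = a' at *
  generalize star b = b' at *
  generalize star c = c' at *
  have e1 : a * b' * (b * c') = a * c' := by linear_combination a * c' * hy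
  have e2 : b * c' * (c * a') = b * a' := by linear_combination b * a' * hz
  have e3 : c * a' * (a * b') = c * b' := by linear_combination c * b' * hx
  have e4 : a * b' * (b * c') * (c * a') = 1 := by
    rw [e1]
    linear_combination c * c' * hx + hz
  linear_combination h1 + h2 + h3 + e1 + e2 + e3 - e4

theorem abs_sinTriangle_le (x y z : ℤ × ℤ) :
    |sinTriangle x y z| ≤ ‖phase x - phase y‖ * ‖phase y - phase z‖ * ‖phase z - phase x‖ := by
  have h : ∀ n m : ℤ × ℤ, ‖1 - phase n * star (phase m)‖ = ‖phase n - phase m‖ := by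
    intro n m
    have : phase n - phase m = -((1 - phase n * star (phase m)) * phase m) := by
      linear_combination (-phase n) * star_mul_phase m
    rw [this, norm_neg, norm_mul, norm_phase, mul_one]
  have e := congrArg norm (one_sub_phase_mul x y z)
  rw [norm_mul, norm_mul, h, h, h] at e
  rw [e]
  simp
  linarith [abs_nonneg (sinTriangle x y z)]

theorem summable_sinTriangle (x y z : ℤ × ℤ) :
    Summable fun a : ℤ × ℤ => sinTriangle (x + a) (y + a) (z + a) := by
  have key : ∀ n m : ℤ × ℤ, ∃ C : ℝ, 0 ≤ C ∧ ∀ a,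
      ‖phase (n + a) - phase (m + a)‖ ≤ C * (fluxDist a)⁻¹ := by
    intro n m
    refine ⟨2 * ‖site n - site m‖ * (3 * Real.exp ‖site n‖), by positivity, fun a => ?_⟩
    refine (norm_phase_sub_le _ _).trans ?_
    have h := inv_fluxDist_le one_pos a (n + a)
    have e1 : site a - site (n + a) = -site n := by rw [site_add]; ring
    have e2 : site (n + a) - site (m + a) = site n - site m := by rw [site_add, site_add]; ring
    rw [e1, norm_neg, one_mul] at h
    norm_num at h
    rw [e2]
    calc _ ≤ 2 * ‖site n - site m‖ * (3 * Real.exp ‖site n‖ * (fluxDist a)⁻¹) := by gcongr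
      _ = _ := by ring
  obtain ⟨C1, h1, H1⟩ := key x y
  obtain ⟨C2, h2, H2⟩ := key y z
  obtain ⟨C3, h3, H3⟩ := key z x
  refine Summable.of_norm_bounded (summable_inv_fluxDist_pow.mul_left (C1 * C2 * C3)) fun a => ?_
  rw [Real.norm_eq_abs]
  refine (abs_sinTriangle_le _ _ _).trans ?_
  have ha := inv_pos.mpr (fluxDist_pos a)
  calc _ ≤ C1 * (fluxDist a)⁻¹ * (C2 * (fluxDist a)⁻¹) * (C3 * (fluxDist a)⁻¹) := by
        gcongr
        exacts [H1 a, H2 a, H3 a]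
    _ = _ := by ring

/-- The sum of `sinTriangle` over all translates of a lattice triangle. -/
def triangleSum (x y z : ℤ × ℤ) : ℝ := ∑' a, sinTriangle (x + a) (y + a) (z + a)

theorem triangleSum_add_right (x y z t : ℤ × ℤ) :
    triangleSum (x + t) (y + t) (z + t) = triangleSum x y z := by
  unfold triangleSum
  rw [← (Equiv.addLeft t).tsum_eq fun a => sinTriangle (x + a) (y + a) (z + a)]
  simp [add_assoc]

theorem triangleSum_reverse (x y z : ℤ × ℤ) : triangleSum z y x = -triangleSum x y z := by
  unfold triangleSum
  rw [← tsum_neg]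
  congr 1
  ext a
  unfold sinTriangle
  rw [sinAngle_swap (y + a), sinAngle_swap (x + a) (y + a), sinAngle_swap (z + a) (x + a)]
  ring

theorem phase_reflect (n : ℤ × ℤ) : phase ((-1, -1) - n) = -phase n := by
  have e : site ((-1, -1) - n) + fluxPoint = -(site n + fluxPoint) := by
    rw [site_sub]
    simp only [site, fluxPoint]
    push_cast
    ring
  unfold phase
  rw [e, norm_neg, neg_div]

/-- Point reflection at the flux tube preserves `triangleSum`, because it maps the lattice to
itself. -/
theorem triangleSum_neg (x y z : ℤ × ℤ) : triangleSum (-x) (-y) (-z) = triangleSum x y z := by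
  unfold triangleSum
  rw [← (Equiv.subLeft ((-1, -1) : ℤ × ℤ)).tsum_eq fun a => sinTriangle (-x + a) (-y + a) (-z + a)]
  congr 1
  ext a
  have e : ∀ n : ℤ × ℤ, -n + ((-1, -1) - a) = (-1, -1) - (n + a) := fun n => by abel
  simp only [Equiv.subLeft_apply, e, sinTriangle, sinAngle, phase_reflect, star_neg, neg_mul_neg]

theorem triangleSum_cocycle (x y z w : ℤ × ℤ) :
    triangleSum y z w - triangleSum x z w + triangleSum x y w - triangleSum x y z = 0 := by
  unfold triangleSum
  rw [← (summable_sinTriangle y z w).tsum_sub (summable_sinTriangle x z w),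
    ← ((summable_sinTriangle y z w).sub (summable_sinTriangle x z w)).tsum_add
      (summable_sinTriangle x y w),
    ← (((summable_sinTriangle y z w).sub (summable_sinTriangle x z w)).add
      (summable_sinTriangle x y w)).tsum_sub (summable_sinTriangle x y z)]
  convert tsum_zero with a
  unfold sinTriangle
  rw [sinAngle_swap (x + a) (w + a), sinAngle_swap (y + a) (w + a), sinAngle_swap (x + a) (z + a)]
  ring

/-- The group cocycle on `ℤ²` defined by `triangleSum`. -/
def areaCocycle (s t : ℤ × ℤ) : ℝ := triangleSum 0 s (s + t)

theorem areaCocycle_swap (s t : ℤ × ℤ) : areaCocycle t s = -areaCocycle s t := by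
  unfold areaCocycle
  rw [← triangleSum_neg, ← triangleSum_add_right _ _ _ (s + t), ← triangleSum_reverse]
  congr 1 <;> abel

theorem areaCocycle_cocycle (s t r : ℤ × ℤ) :
    areaCocycle t r - areaCocycle (s + t) r + areaCocycle s (t + r) - areaCocycle s t = 0 := by
  have h := triangleSum_cocycle 0 s (s + t) (s + t + r)
  have h2 := triangleSum_add_right 0 t (t + r) s
  have e1 : 0 + s = s := zero_add s
  have e2 : t + s = s + t := add_comm t s
  have e3 : t + r + s = s + t + r := by abel
  rw [e1, e2, e3] at h2
  rw [h2] at h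
  unfold areaCocycle
  rw [← add_assoc s t r]
  exact h

/-- Additivity, which holds for every antisymmetric 2-cocycle on an abelian group: the cocycle
identities for the cyclic permutations of `s`, `t`, `r` combine to it. -/
theorem areaCocycle_add_left (s t r : ℤ × ℤ) :
    areaCocycle (s + t) r = areaCocycle s r + areaCocycle t r := by
  have h1 := areaCocycle_cocycle s t r
  have h2 := areaCocycle_cocycle t r s
  have h3 := areaCocycle_cocycle r s t
  rw [areaCocycle_swap (t + r) s] at h1
  rw [areaCocycle_swap (r + s) t] at h2
  rw [areaCocycle_swap (s + t) r] at h3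
  linarith [areaCocycle_swap s t, areaCocycle_swap s r, areaCocycle_swap t r]

theorem addMonoidHom_int_prod_apply (f : ℤ × ℤ →+ ℝ) (n : ℤ × ℤ) :
    f n = n.1 * f (1, 0) + n.2 * f (0, 1) := by
  have e : n = n.1 • ((1, 0) : ℤ × ℤ) + n.2 • ((0, 1) : ℤ × ℤ) := by
    ext <;> simp
  conv_lhs => rw [e]
  rw [map_add, map_zsmul, map_zsmul]
  simp

theorem areaCocycle_eq_det_mul (s t : ℤ × ℤ) :
    areaCocycle s t = (s.1 * t.2 - s.2 * t.1) * areaCocycle (1, 0) (0, 1) := by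
  have hl : ∀ s t : ℤ × ℤ,
      areaCocycle s t = s.1 * areaCocycle (1, 0) t + s.2 * areaCocycle (0, 1) t := fun s t =>
    addMonoidHom_int_prod_apply
      (AddMonoidHom.mk' (fun s => areaCocycle s t) fun a b => areaCocycle_add_left a b t) s
  have hself : ∀ s, areaCocycle s s = 0 := fun s => by linarith [areaCocycle_swap s s]
  have h1 : areaCocycle (1, 0) t = t.2 * areaCocycle (1, 0) (0, 1) := by
    rw [areaCocycle_swap t, hl t, hself, areaCocycle_swap (1, 0) (0, 1)]
    ring
  have h2 : areaCocycle (0, 1) t = -t.1 * areaCocycle (1, 0) (0, 1) := by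
    rw [areaCocycle_swap t, hl t, hself]
    ring
  rw [hl, h1, h2]
  ring

/-! ### Normalization of the area formula -/

theorem sum_Ico_int_sub (f : ℤ → ℝ) {a b : ℤ} (hab : a ≤ b) :
    ∑ i ∈ Finset.Ico a b, (f (i + 1) - f i) = f b - f a := by
  induction b, hab using Int.leInduction with
  | base => simp
  | succ n hn ih =>
    rw [← Finset.insert_Ico_right_eq_Ico_add_one hn, Finset.sum_insert (by simp), ih]
    ring

theorem sinAngle_eq (n m : ℤ × ℤ) : sinAngle n m =
    (((n.2 : ℝ) + 1 / 2) * (m.1 + 1 / 2) - (n.1 + 1 / 2) * (m.2 + 1 / 2)) /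
      (fluxDist n * fluxDist m) := by
  have h : ∀ n : ℤ × ℤ, phase n = (((n.1 : ℝ) + 1 / 2 : ℝ) + ((n.2 : ℝ) + 1 / 2 : ℝ) * Complex.I) *
      ((fluxDist n)⁻¹ : ℝ) := by
    intro n
    unfold phase fluxDist site fluxPoint
    push_cast
    rw [div_eq_mul_inv]
    ring
  unfold sinAngle
  rw [h n, h m]
  simp only [Complex.star_def, map_mul, map_add, Complex.conj_ofReal, Complex.conj_I,
    Complex.mul_im, Complex.mul_re, Complex.add_re, Complex.add_im, Complex.ofReal_re,
    Complex.ofReal_im, Complex.I_re, Complex.I_im, Complex.neg_re, Complex.neg_im]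
  field_simp
  ring

theorem fluxDist_eq_sqrt (n : ℤ × ℤ) :
    fluxDist n = √(((n.1 : ℝ) + 1 / 2) ^ 2 + ((n.2 : ℝ) + 1 / 2) ^ 2) := by
  have e : site n + fluxPoint =
      (((n.1 : ℝ) + 1 / 2 : ℝ) : ℂ) + (((n.2 : ℝ) + 1 / 2 : ℝ) : ℂ) * Complex.I := by
    unfold site fluxPoint
    push_cast
    ring
  unfold fluxDist
  rw [e, Complex.norm_add_mul_I]

/-- The angle under which the segment from `0` to `i + 1/2` is seen at distance `L`. -/
def sideAngle (L : ℝ) (i : ℤ) : ℝ := Real.arctan (((i : ℝ) + 1 / 2) / L)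

theorem sin_sideAngle_sub {L : ℝ} (hL : 0 < L) (i : ℤ) :
    Real.sin (sideAngle L (i + 1) - sideAngle L i) =
      L / (√(((i : ℝ) + 1 / 2) ^ 2 + L ^ 2) * √((((i + 1 : ℤ) : ℝ) + 1 / 2) ^ 2 + L ^ 2)) := by
  have h : ∀ x : ℝ, √(1 + (x / L) ^ 2) = √(x ^ 2 + L ^ 2) / L := by
    intro x
    rw [show 1 + (x / L) ^ 2 = (x ^ 2 + L ^ 2) / L ^ 2 by field_simp; ring,
      Real.sqrt_div (by positivity), Real.sqrt_sq hL.le]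
  unfold sideAngle
  rw [Real.sin_sub, Real.sin_arctan, Real.cos_arctan, Real.sin_arctan, Real.cos_arctan, h, h]
  have h1 : 0 < √(((i : ℝ) + 1 / 2) ^ 2 + L ^ 2) := Real.sqrt_pos.mpr (by positivity)
  have h2 : 0 < √((((i + 1 : ℤ) : ℝ) + 1 / 2) ^ 2 + L ^ 2) := Real.sqrt_pos.mpr (by positivity)
  push_cast at *
  field_simp
  ring

/-- The sines of the angles under which the segments of one side of a large square are seen sum to a
quarter turn in the limit. -/
theorem tendsto_sum_sin_sideAngle :
    Filter.Tendsto (fun N : ℕ => ∑ i ∈ Finset.Ico (-(N : ℤ) - 1) N,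
      Real.sin (sideAngle (N + 1 / 2) (i + 1) - sideAngle (N + 1 / 2) i))
      Filter.atTop (nhds (Real.pi / 2)) := by
  have hang : ∀ N : ℕ, ∑ i ∈ Finset.Ico (-(N : ℤ) - 1) N,
      (sideAngle (N + 1 / 2) (i + 1) - sideAngle (N + 1 / 2) i) = Real.pi / 2 := by
    intro N
    rw [sum_Ico_int_sub _ (by omega)]
    have hN : (N : ℝ) + 1 / 2 ≠ 0 := by positivity
    unfold sideAngle
    have e1 : (((N : ℤ) : ℝ) + 1 / 2) / ((N : ℝ) + 1 / 2) = 1 := by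
      rw [Int.cast_natCast, div_self hN]
    have e2 : (((-(N : ℤ) - 1 : ℤ) : ℝ) + 1 / 2) / ((N : ℝ) + 1 / 2) = -1 := by
      rw [div_eq_iff hN]
      push_cast
      ring
    rw [e1, e2, Real.arctan_neg, Real.arctan_one]
    ring
  have hbound : ∀ N : ℕ, 2 ≤ N → |∑ i ∈ Finset.Ico (-(N : ℤ) - 1) N,
      Real.sin (sideAngle (N + 1 / 2) (i + 1) - sideAngle (N + 1 / 2) i) - Real.pi / 2| ≤
        Real.pi ^ 3 * (1 / ((N : ℝ) + 1)) := by
    intro N hN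
    have hN2 : (2 : ℝ) ≤ N := by exact_mod_cast hN
    set L : ℝ := N + 1 / 2 with hL
    have hLpos : 0 < L := by positivity
    have hpi := Real.pi_pos
    rw [← hang N, ← Finset.sum_sub_distrib]
    refine (Finset.abs_sum_le_sum_abs _ _).trans ?_
    have hterm : ∀ i ∈ Finset.Ico (-(N : ℤ) - 1) N,
        |Real.sin (sideAngle L (i + 1) - sideAngle L i) - (sideAngle L (i + 1) - sideAngle L i)| ≤
          (Real.pi / (2 * L)) ^ 3 / 6 := by
      intro i hi
      rw [Finset.mem_Ico] at hi
      have hi1 : (-(N : ℝ) - 1) ≤ i := by exact_mod_cast hi.1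
      have hi2 : (i : ℝ) + 1 ≤ N := by exact_mod_cast hi.2
      set Δ := sideAngle L (i + 1) - sideAngle L i with hΔ
      have h0 : 0 < Δ := by
        rw [hΔ, sub_pos]
        refine Real.arctan_strictMono ?_
        push_cast
        gcongr
        linarith
      have h1 : Δ ≤ Real.pi / 2 := by
        have a1 : sideAngle L (i + 1) ≤ Real.pi / 4 := by
          rw [← Real.arctan_one]
          refine Real.arctan_strictMono.monotone ?_
          rw [div_le_one hLpos]
          push_cast
          linarith
        have a2 : -(Real.pi / 4) ≤ sideAngle L i := by
          rw [← Real.arctan_one, ← Real.arctan_neg]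
          refine Real.arctan_strictMono.monotone ?_
          rw [le_div_iff₀ hLpos]
          linarith
        linarith
      have hs : Real.sin Δ ≤ 1 / L := by
        rw [hΔ, sin_sideAngle_sub hLpos]
        have b : ∀ x : ℝ, L ≤ √(x ^ 2 + L ^ 2) := fun x => Real.le_sqrt_of_sq_le (by nlinarith)
        rw [div_le_div_iff₀ (mul_pos (hLpos.trans_le (b _)) (hLpos.trans_le (b _))) hLpos, one_mul]
        exact mul_le_mul (b _) (b _) hLpos.le (hLpos.le.trans (b _))
      have hj := Real.mul_le_sin h0.le h1
      have hΔL : Δ ≤ Real.pi / (2 * L) := by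
        have h2 : 2 / Real.pi * Δ ≤ 1 / L := hj.trans hs
        rw [le_div_iff₀ (by positivity)]
        rw [div_mul_eq_mul_div, div_le_div_iff₀ hpi hLpos] at h2
        linarith
      rw [abs_sub_comm, abs_of_nonneg (by linarith [Real.sin_le h0.le])]
      have h3 := Real.sin_gt_sub_cube h0
      have h4 : Δ ^ 3 ≤ (Real.pi / (2 * L)) ^ 3 := by gcongr
      linarith
    refine (Finset.sum_le_card_nsmul _ _ _ hterm).trans ?_
    rw [Int.card_Ico, nsmul_eq_mul]
    have hc : (((N : ℤ) - (-(N : ℤ) - 1)).toNat : ℝ) = 2 * L := by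
      have : ((N : ℤ) - (-(N : ℤ) - 1)).toNat = 2 * N + 1 := by omega
      rw [this, hL]
      push_cast
      ring
    rw [hc]
    have e : 2 * L * ((Real.pi / (2 * L)) ^ 3 / 6) = Real.pi ^ 3 * (1 / (24 * L ^ 2)) := by
      field_simp
      ring
    rw [e]
    gcongr
    nlinarith
  have hlim : Filter.Tendsto (fun N : ℕ => Real.pi ^ 3 * (1 / ((N : ℝ) + 1))) Filter.atTop
      (nhds 0) := by
    simpa using tendsto_one_div_add_atTop_nhds_zero_nat.const_mul (Real.pi ^ 3)
  rw [tendsto_iff_dist_tendsto_zero]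
  refine squeeze_zero' (Filter.Eventually.of_forall fun _ => dist_nonneg) ?_ hlim
  filter_upwards [Filter.eventually_ge_atTop 2] with N hN
  rw [Real.dist_eq]
  exact hbound N hN

theorem tendsto_Ico_prod_Ico :
    Filter.Tendsto (fun N : ℕ => Finset.Ico (-(N : ℤ) - 1) N ×ˢ Finset.Ico (-(N : ℤ) - 1) (N : ℤ))
      Filter.atTop Filter.atTop := by
  refine Filter.tendsto_atTop_finset_of_monotone (fun N M hNM => ?_) fun n => ?_
  · have : (N : ℤ) ≤ M := by exact_mod_cast hNM
    exact Finset.product_subset_product (Finset.Ico_subset_Ico (by omega) this)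
      (Finset.Ico_subset_Ico (by omega) this)
  · refine ⟨n.1.natAbs + n.2.natAbs + 1, ?_⟩
    simp only [Finset.mem_product, Finset.mem_Ico]
    omega

/-- The sum of the sines around all unit squares telescopes to the boundary of a large square, which
is seen under the full angle. -/
theorem areaCocycle_one : areaCocycle (1, 0) (0, 1) = -Real.pi := by
  set β := areaCocycle (1, 0) (0, 1) with hβ
  have h1 : HasSum (fun a : ℤ × ℤ => sinTriangle (0 + a) ((1, 0) + a) ((1, 0) + (0, 1) + a)) β :=
    (summable_sinTriangle _ _ _).hasSum
  have h2 : HasSum (fun a : ℤ × ℤ => sinTriangle (0 + a) ((0, 1) + a) ((0, 1) + (1, 0) + a))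
      (areaCocycle (0, 1) (1, 0)) := (summable_sinTriangle _ _ _).hasSum
  rw [areaCocycle_swap, ← hβ] at h2
  have h3 := h1.sub h2
  have h4 := h3.comp tendsto_Ico_prod_Ico
  have h5 : ∀ N : ℕ, ∑ a ∈ Finset.Ico (-(N : ℤ) - 1) N ×ˢ Finset.Ico (-(N : ℤ) - 1) (N : ℤ),
      (sinTriangle (0 + a) ((1, 0) + a) ((1, 0) + (0, 1) + a) -
        sinTriangle (0 + a) ((0, 1) + a) ((0, 1) + (1, 0) + a)) =
      -4 * ∑ i ∈ Finset.Ico (-(N : ℤ) - 1) N,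
      Real.sin (sideAngle (N + 1 / 2) (i + 1) - sideAngle (N + 1 / 2) i) := by
    intro N
    set I := Finset.Ico (-(N : ℤ) - 1) N with hI
    set h : ℤ → ℤ → ℝ := fun i j => sinAngle (i, j) (i + 1, j) with hh
    set v : ℤ → ℤ → ℝ := fun i j => sinAngle (i, j) (i, j + 1) with hv
    have e1 : ∀ a : ℤ × ℤ, sinTriangle (0 + a) ((1, 0) + a) ((1, 0) + (0, 1) + a) -
        sinTriangle (0 + a) ((0, 1) + a) ((0, 1) + (1, 0) + a) =
        (v (a.1 + 1) a.2 - v a.1 a.2) - (h a.1 (a.2 + 1) - h a.1 a.2) := by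
      rintro ⟨i, j⟩
      simp only [hh, hv, sinTriangle, Prod.mk_add_mk, zero_add, add_comm (1 : ℤ)]
      ring
    have e2 : ∑ a ∈ I ×ˢ I, (v (a.1 + 1) a.2 - v a.1 a.2) =
        ∑ j ∈ I, (v N j - v (-(N : ℤ) - 1) j) := by
      rw [Finset.sum_product_right]
      refine Finset.sum_congr rfl fun j _ => ?_
      exact sum_Ico_int_sub (fun i => v i j) (by omega)
    have e3 : ∑ a ∈ I ×ˢ I, (h a.1 (a.2 + 1) - h a.1 a.2) =
        ∑ i ∈ I, (h i N - h i (-(N : ℤ) - 1)) := by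
      rw [Finset.sum_product]
      refine Finset.sum_congr rfl fun i _ => ?_
      exact sum_Ico_int_sub (fun j => h i j) (by omega)
    simp only [e1]
    rw [Finset.sum_sub_distrib, e2, e3, ← Finset.sum_sub_distrib, Finset.mul_sum]
    refine Finset.sum_congr rfl fun i _ => ?_
    rw [sin_sideAngle_sub (by positivity)]
    simp only [hh, hv, sinAngle_eq, fluxDist_eq_sqrt]
    have r : ((-(N : ℤ) - 1 : ℤ) : ℝ) + 1 / 2 = -((N : ℝ) + 1 / 2) := by
      push_cast
      ring
    rw [r, Int.cast_natCast]
    simp only [neg_sq]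
    set L : ℝ := (N : ℝ) + 1 / 2
    rw [add_comm (L ^ 2), add_comm (L ^ 2)]
    push_cast
    ring
  have h6 : Filter.Tendsto (fun N : ℕ => -4 * ∑ i ∈ Finset.Ico (-(N : ℤ) - 1) N,
      Real.sin (sideAngle (N + 1 / 2) (i + 1) - sideAngle (N + 1 / 2) i))
      Filter.atTop (nhds (β - -β)) := by
    refine h4.congr fun N => ?_
    exact h5 N
  have h7 := tendsto_nhds_unique h6 (tendsto_sum_sin_sideAngle.const_mul (-4))
  linarith

/-- Connes' area formula: summed over the translates of the triangle, the product of the phase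
differences along the sides of a lattice triangle is `2 π i` times twice its signed area. -/
theorem hasSum_one_sub_phase_mul (s t : ℤ × ℤ) :
    HasSum (fun a : ℤ × ℤ => (1 - phase a * star (phase (a + (s + t)))) *
      (1 - phase (a + (s + t)) * star (phase (a + t))) * (1 - phase (a + t) * star (phase a)))
      (2 * Real.pi * Complex.I * (s.1 * t.2 - s.2 * t.1)) := by
  have h1 : HasSum (fun a : ℤ × ℤ => sinTriangle (0 + a) (s + t + a) (t + a))
      (-(Real.pi * (s.1 * t.2 - s.2 * t.1))) := by
    have h := (summable_sinTriangle 0 (s + t) t).hasSum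
    convert h using 1
    change _ = triangleSum 0 (s + t) t
    have e : triangleSum 0 (s + t) t = areaCocycle s t := by
      rw [← neg_neg (areaCocycle s t), ← areaCocycle_swap]
      unfold areaCocycle
      rw [← triangleSum_reverse, add_comm t s]
      unfold triangleSum sinTriangle
      congr 1
      ext a
      ring
    rw [e, areaCocycle_eq_det_mul, areaCocycle_one]
    ring
  have h2 := (Complex.hasSum_ofReal.mpr h1).mul_left (-2 * Complex.I)
  have e : (2 * Real.pi * Complex.I * (s.1 * t.2 - s.2 * t.1) : ℂ) =
      -2 * Complex.I * ((-(Real.pi * (s.1 * t.2 - s.2 * t.1)) : ℝ) : ℂ) := by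
    push_cast
    ring
  rw [e]
  refine h2.congr_fun fun a => ?_
  rw [one_sub_phase_mul, zero_add, add_comm a, add_comm a]

end

section

/-! ### The index as a sum over hopping matrices -/

variable {K : ℕ} {P : H K →L[ℂ] H K}

/-- The hopping matrix `⟨s, α| P |0, β⟩`. -/
def hop (P : H K →L[ℂ] H K) (s : ℤ × ℤ) : Matrix (Fin K) (Fin K) ℂ :=
  Matrix.of fun α β => entry P (s, α) (0, β)

theorem hop_apply (s : ℤ × ℤ) (α β : Fin K) : hop P s α β = entry P (s, α) (0, β) := rfl

theorem IsLocalizedProjector.entry_eq_hop (hP : IsLocalizedProjector P)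
    (x y : (ℤ × ℤ) × Fin K) : entry P x y = hop P (x.1 - y.1) x.2 y.2 := by
  obtain ⟨n, α⟩ := x
  obtain ⟨m, β⟩ := y
  have h := hP.translation_comm m (ket 0 β)
  rw [translation_ket, zero_add] at h
  change P (ket m β) (n, α) = P (ket 0 β) (n - m, α)
  rw [← h, translation_apply]

theorem summable_exp_mul_exp_mul_inv_fluxDist_pow (K : ℕ) {δ : ℝ} (hδ : 0 < δ) :
    Summable fun p : ((ℤ × ℤ) × Fin K) × ((ℤ × ℤ) × Fin K) × ((ℤ × ℤ) × Fin K) =>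
      Real.exp (-δ * ‖site p.1.1 - site p.2.1.1‖) * (fluxDist p.1.1)⁻¹ ^ 3 *
        Real.exp (-δ * ‖site p.1.1 - site p.2.2.1‖) := by
  rw [← (Equiv.prodAssoc _ _ _).summable_iff]
  have hnn : 0 ≤ fun p : (((ℤ × ℤ) × Fin K) × ((ℤ × ℤ) × Fin K)) × ((ℤ × ℤ) × Fin K) =>
      Real.exp (-δ * ‖site p.1.1.1 - site p.1.2.1‖) * (fluxDist p.1.1.1)⁻¹ ^ 3 *
        Real.exp (-δ * ‖site p.1.1.1 - site p.2.1‖) := fun p => by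
    have := fluxDist_pos p.1.1.1
    positivity
  have hfib : ∀ q : ((ℤ × ℤ) × Fin K) × ((ℤ × ℤ) × Fin K), HasSum (fun z : (ℤ × ℤ) × Fin K =>
      Real.exp (-δ * ‖site q.1.1 - site q.2.1‖) * (fluxDist q.1.1)⁻¹ ^ 3 *
        Real.exp (-δ * ‖site q.1.1 - site z.1‖))
      (Real.exp (-δ * ‖site q.1.1 - site q.2.1‖) * (fluxDist q.1.1)⁻¹ ^ 3 * expSum K δ) :=
    fun q => (hasSum_exp_site_sub K hδ q.1.1).mul_left _
  refine (summable_prod_of_nonneg hnn).mpr ⟨fun q => (hfib q).summable, ?_⟩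
  exact ((summable_inv_fluxDist_pow_mul_exp K hδ).mul_right _).congr
    fun q => (hfib q).tsum_eq.symm

/-- The triple sum that expresses the diagonal of a cube converges absolutely if the matrix decays
like `|x + n₀|⁻¹` along the diagonal. -/
theorem Decays.summable_triple {R : H K →L[ℂ] H K} (hR : Decays 1 R) :
    Summable fun p : ((ℤ × ℤ) × Fin K) × ((ℤ × ℤ) × Fin K) × ((ℤ × ℤ) × Fin K) =>
      entry R p.1 p.2.1 * (entry R p.2.1 p.2.2 * entry R p.2.2 p.1) := by
  obtain ⟨C, γ, hC, hγ, h⟩ := hR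
  have hγ2 : 0 < γ / 2 := half_pos hγ
  set M := 1 + 2 / (γ / 2) with hM
  have hMpos : 0 < M := by positivity
  refine Summable.of_norm_bounded
    ((summable_exp_mul_exp_mul_inv_fluxDist_pow K hγ2).mul_left (C ^ 3 * M ^ 2)) ?_
  rintro ⟨x, y, z⟩
  have hx := inv_pos.mpr (fluxDist_pos x.1)
  have hy := inv_pos.mpr (fluxDist_pos y.1)
  have hz := inv_pos.mpr (fluxDist_pos z.1)
  have h1 := h x y
  have h2 := h y z
  have h3 := h z x
  rw [norm_sub_rev (site z.1)] at h3
  have h4 := inv_fluxDist_le hγ2 x.1 y.1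
  have h5 := inv_fluxDist_le hγ2 x.1 z.1
  rw [← hM] at h4 h5
  simp only [norm_mul, pow_one] at *
  set a := ‖site x.1 - site y.1‖
  set b := ‖site x.1 - site z.1‖
  have h2' : ‖entry R y z‖ ≤ C * (M * Real.exp (γ / 2 * a) * (fluxDist x.1)⁻¹) := by
    refine h2.trans ?_
    have : Real.exp (-γ * ‖site y.1 - site z.1‖) ≤ 1 := by
      rw [Real.exp_le_one_iff]
      have := norm_nonneg (site y.1 - site z.1)
      nlinarith
    calc C * Real.exp (-γ * ‖site y.1 - site z.1‖) * (fluxDist y.1)⁻¹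
        ≤ C * 1 * (M * Real.exp (γ / 2 * a) * (fluxDist x.1)⁻¹) := by gcongr
      _ = _ := by ring
  have h3' : ‖entry R z x‖ ≤
      C * Real.exp (-γ * b) * (M * Real.exp (γ / 2 * b) * (fluxDist x.1)⁻¹) :=
    h3.trans (by gcongr)
  calc ‖entry R x y‖ * (‖entry R y z‖ * ‖entry R z x‖)
      ≤ (C * Real.exp (-γ * a) * (fluxDist x.1)⁻¹) *
        ((C * (M * Real.exp (γ / 2 * a) * (fluxDist x.1)⁻¹)) *
          (C * Real.exp (-γ * b) * (M * Real.exp (γ / 2 * b) * (fluxDist x.1)⁻¹))) := by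
        gcongr
    _ = C ^ 3 * M ^ 2 * (Real.exp (-γ * a + γ / 2 * a) * (fluxDist x.1)⁻¹ ^ 3 *
        Real.exp (-γ * b + γ / 2 * b)) := by
        rw [Real.exp_add, Real.exp_add]
        ring
    _ = _ := by
        congr 4 <;> ring

theorem hasSum_of_eq {β : Type*} {f : β → ℂ} {a b : ℂ} (h : HasSum f a) (e : b = a) : HasSum f b :=
  e ▸ h

theorem hasSum_triple_of_hasSum_diag {ι : Type*} [DecidableEq ι] {R : Ell2 ι →L[ℂ] Ell2 ι} {c : ℂ}
    (hs : Summable fun p : ι × ι × ι =>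
      entry R p.1 p.2.1 * (entry R p.2.1 p.2.2 * entry R p.2.2 p.1))
    (hR : HasSum (fun x => entry (R ^ 3) x x) c) :
    HasSum (fun p : ι × ι × ι =>
      entry R p.1 p.2.1 * (entry R p.2.1 p.2.2 * entry R p.2.2 p.1)) c := by
  refine hasSum_of_eq hs.hasSum ?_
  have hdiag : ∀ x, HasSum (fun q : ι × ι => entry R x q.1 * (entry R q.1 q.2 * entry R q.2 x))
      (entry (R ^ 3) x x) := by
    intro x
    have hx : Summable fun q : ι × ι => entry R x q.1 * (entry R q.1 q.2 * entry R q.2 x) :=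
      hs.prod_factor x
    refine hasSum_of_eq hx.hasSum ?_
    have hy : ∀ y, HasSum (fun z => entry R x y * (entry R y z * entry R z x))
        (entry R x y * entry (R * R) y x) := fun y => (hasSum_entry_mul R R y x).mul_left _
    have h := hx.hasSum.prod_fiberwise hy
    rw [pow_three]
    exact (hasSum_entry_mul R (R * R) x x).unique h
  exact hR.unique (hs.hasSum.prod_fiberwise hdiag)

/-- The parametrization of a triple of indices by two hopping vectors and a base point. -/
def tripleEquiv (K : ℕ) : ((ℤ × ℤ) × (ℤ × ℤ)) × ((ℤ × ℤ) × (Fin K × Fin K × Fin K)) ≃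
    ((ℤ × ℤ) × Fin K) × ((ℤ × ℤ) × Fin K) × ((ℤ × ℤ) × Fin K) where
  toFun p := ((p.2.1, p.2.2.1), (p.2.1 + (p.1.1 + p.1.2), p.2.2.2.1), (p.2.1 + p.1.2, p.2.2.2.2))
  invFun q := ((q.2.1.1 - q.2.2.1, q.2.2.1 - q.1.1), (q.1.1, (q.1.2, q.2.1.2, q.2.2.2)))
  left_inv := by
    rintro ⟨⟨s, t⟩, a, α, β, δ⟩
    simp
  right_inv := by
    rintro ⟨⟨x, α⟩, ⟨y, β⟩, ⟨z, δ⟩⟩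
    simp

/-- The index as a lattice sum over pairs of hopping vectors, obtained by summing
`Tr (P - Q)³` over the base point with the area formula. -/
theorem IsLocalizedProjector.hasSum_hop (hP : IsLocalizedProjector P) :
    HasSum (fun q : (ℤ × ℤ) × (ℤ × ℤ) => (hop P (-(q.1 + q.2)) * hop P q.1 * hop P q.2).trace *
      (2 * Real.pi * Complex.I * (q.1.1 * q.2.2 - q.1.2 * q.2.1)))
      (-(index (fluxCompression P) : ℂ)) := by
  have hR : ∀ x y, entry (P - fluxOp K * P * star (fluxOp K)) x y =
      entry P x y * (1 - phase x.1 * star (phase y.1)) := by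
    intro x y
    rw [entry_sub, entry_mul_star_fluxOp, entry_fluxOp_mul]
    ring
  have hRd : Decays 1 (P - fluxOp K * P * star (fluxOp K)) := by
    refine hP.decays.of_norm_entry_le fun x y => ?_
    rw [hR, norm_mul]
    refine mul_le_mul_of_nonneg_left (le_of_eq ?_) (norm_nonneg _)
    have : phase x.1 - phase y.1 = -((1 - phase x.1 * star (phase y.1)) * phase y.1) := by
      linear_combination (-phase x.1) * star_mul_phase y.1
    rw [this, norm_neg, norm_mul, norm_phase, mul_one]
  have h1 := hasSum_triple_of_hasSum_diag hRd.summable_triple hP.hasSum_diag_pow_three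
  rw [← (tripleEquiv K).hasSum_iff] at h1
  refine h1.prod_fiberwise ?_
  -- for fixed hopping vectors, the sum over the base point is the area formula
  rintro ⟨s, t⟩
  have h2 := h1.summable.prod_factor (s, t)
  refine hasSum_of_eq h2.hasSum ?_
  refine ((hasSum_one_sub_phase_mul s t).mul_left
    (hop P (-(s + t)) * hop P s * hop P t).trace).unique (h2.hasSum.prod_fiberwise fun a => ?_)
  refine hasSum_of_eq (hasSum_fintype _) ?_
  simp only [Function.comp_apply, tripleEquiv, Equiv.coe_fn_mk, hR, hP.entry_eq_hop]
  have e1 : a - (a + (s + t)) = -(s + t) := by abel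
  have e2 : a + (s + t) - (a + t) = s := by abel
  have e3 : a + t - a = t := by abel
  simp only [e1, e2, e3, Fintype.sum_prod_type, Matrix.trace, Matrix.diag, Matrix.mul_apply,
    Finset.sum_mul]
  refine Finset.sum_congr rfl fun α _ => ?_
  rw [Finset.sum_comm]
  refine Finset.sum_congr rfl fun β _ => Finset.sum_congr rfl fun δ _ => ?_
  ring

end

section

/-! ### Analyticity of sums of power series -/

open scoped NNReal ENNReal in
/-- A sum of functions with power series that are summable in norm, uniformly on a ball, is
analytic. -/
theorem hasFPowerSeriesOnBall_tsum {ι E F : Type*} [NormedAddCommGroup E] [NormedSpace ℝ E]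
    [NormedAddCommGroup F] [NormedSpace ℝ F] [CompleteSpace F]
    (p : ι → FormalMultilinearSeries ℝ E F) (φ : ι → E → F) (x : E) {r : ℝ≥0} (hr : 0 < r)
    {u : ι → ℝ} (hu : Summable u) (hb : ∀ i n, ‖p i n‖ * (r : ℝ) ^ n ≤ u i)
    (hφ : ∀ i y, HasSum (fun n => p i n fun _ => y) (φ i (x + y))) :
    HasFPowerSeriesOnBall (fun z => ∑' i, φ i z) (fun n => ∑' i, p i n) x r := by
  have hr' : (0 : ℝ) < r := hr
  have hu0 : ∀ i, 0 ≤ u i := fun i => by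
    have := hb i 0
    simp only [pow_zero, mul_one] at this
    exact (norm_nonneg _).trans this
  have hs : ∀ n, Summable fun i => ‖p i n‖ := fun n => by
    refine Summable.of_nonneg_of_le (fun _ => norm_nonneg _) (fun i => ?_)
      (hu.mul_right ((r : ℝ) ^ n)⁻¹)
    rw [← div_eq_mul_inv, le_div_iff₀ (by positivity)]
    exact hb i n
  refine ⟨?_, by exact_mod_cast hr, fun {y} hy => ?_⟩
  · refine FormalMultilinearSeries.le_radius_of_bound _ (∑' i, u i) fun n => ?_
    calc ‖∑' i, p i n‖ * (r : ℝ) ^ n ≤ (∑' i, ‖p i n‖) * (r : ℝ) ^ n := by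
          gcongr
          exact norm_tsum_le_tsum_norm (hs n)
      _ = ∑' i, ‖p i n‖ * (r : ℝ) ^ n := tsum_mul_right.symm
      _ ≤ ∑' i, u i := ((hs n).mul_right _).tsum_le_tsum (hb · n) hu
  · have hyr : ‖y‖ < r := by simpa using hy
    set q := ‖y‖ / r
    have hq0 : 0 ≤ q := by positivity
    have hq1 : q < 1 := (div_lt_one hr').mpr hyr
    have hsum : Summable fun z : ι × ℕ => p z.1 z.2 fun _ => y := by
      refine Summable.of_norm_bounded (hu.mul_of_nonneg (summable_geometric_of_lt_one hq0 hq1)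
        hu0 fun n => pow_nonneg hq0 n) fun z => ?_
      refine ((p z.1 z.2).le_opNorm _).trans ?_
      simp only [Finset.prod_const, Finset.card_univ, Fintype.card_fin]
      have e : ‖p z.1 z.2‖ * ‖y‖ ^ z.2 = ‖p z.1 z.2‖ * (r : ℝ) ^ z.2 * q ^ z.2 := by
        rw [mul_assoc, ← mul_pow, mul_div_cancel₀ _ hr'.ne']
      rw [e]
      exact mul_le_mul_of_nonneg_right (hb _ _) (by positivity)
    have h1 : ∑' i, φ i (x + y) = ∑' z : ι × ℕ, p z.1 z.2 fun _ => y :=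
      (hsum.hasSum.prod_fiberwise fun i => hφ i y).tsum_eq
    rw [h1]
    have h2 := (Equiv.prodComm ℕ ι).hasSum_iff.mpr hsum.hasSum
    refine h2.prod_fiberwise fun n => ?_
    have h3 := (hs n).of_norm.hasSum
    have h4 := h3.mapL (ContinuousMultilinearMap.apply ℝ (fun _ : Fin n => E) F fun _ => y)
    exact h4

/-! ### Fourier series with exponentially decaying coefficients -/

/-- The exponential decay of a family of Fourier coefficients. -/
def ExpDecays (f : ℤ × ℤ → ℂ) : Prop :=
  ∃ C γ : ℝ, 0 ≤ C ∧ 0 < γ ∧ ∀ s, ‖f s‖ ≤ C * Real.exp (-γ * ‖site s‖)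

/-- The Fourier series `∑ₛ e^{-i k·s} f(s)`. -/
def fourierSum (f : ℤ × ℤ → ℂ) (k : ℝ × ℝ) : ℂ :=
  ∑' s, Complex.exp (-Complex.I * (kdot k s : ℂ)) * f s

theorem norm_exp_kdot (k : ℝ × ℝ) (s : ℤ × ℤ) :
    ‖Complex.exp (-Complex.I * (kdot k s : ℂ))‖ = 1 := by
  rw [Complex.norm_exp]
  simp

theorem ExpDecays.summable_norm {f : ℤ × ℤ → ℂ} (hf : ExpDecays f) : Summable fun s => ‖f s‖ := by
  obtain ⟨C, γ, hC, hγ, h⟩ := hf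
  exact Summable.of_nonneg_of_le (fun _ => norm_nonneg _) h
    ((summable_exp_neg_norm_site hγ).mul_left C)

theorem ExpDecays.const_mul {f : ℤ × ℤ → ℂ} (hf : ExpDecays f) (c : ℂ) :
    ExpDecays fun s => c * f s := by
  obtain ⟨C, γ, hC, hγ, h⟩ := hf
  refine ⟨‖c‖ * C, γ, by positivity, hγ, fun s => ?_⟩
  rw [norm_mul, mul_assoc]
  exact mul_le_mul_of_nonneg_left (h s) (norm_nonneg _)

theorem ExpDecays.mul_of_le {f c : ℤ × ℤ → ℂ} (hf : ExpDecays f) (hc : ∀ s, ‖c s‖ ≤ ‖site s‖) :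
    ExpDecays fun s => c s * f s := by
  obtain ⟨C, γ, hC, hγ, h⟩ := hf
  refine ⟨2 / γ * C, γ / 2, by positivity, half_pos hγ, fun s => ?_⟩
  have h1 : ‖site s‖ ≤ 2 / γ * Real.exp (γ / 2 * ‖site s‖) := by
    have h2 := Real.add_one_le_exp (γ / 2 * ‖site s‖)
    have h3 : 2 / γ * (γ / 2 * ‖site s‖) = ‖site s‖ := by field_simp
    calc ‖site s‖ = 2 / γ * (γ / 2 * ‖site s‖) := h3.symm
      _ ≤ _ := mul_le_mul_of_nonneg_left (by linarith) (by positivity)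
  rw [norm_mul]
  calc ‖c s‖ * ‖f s‖ ≤ (2 / γ * Real.exp (γ / 2 * ‖site s‖)) * (C * Real.exp (-γ * ‖site s‖)) :=
        mul_le_mul ((hc s).trans h1) (h s) (norm_nonneg _) (by positivity)
    _ = 2 / γ * C * Real.exp (γ / 2 * ‖site s‖ + -γ * ‖site s‖) := by
        rw [Real.exp_add]
        ring
    _ = _ := by
        congr 2
        ring

theorem norm_intCast_fst_le (s : ℤ × ℤ) : ‖(s.1 : ℂ)‖ ≤ ‖site s‖ := by
  have := Complex.abs_re_le_norm (site s)
  rw [site_re] at this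
  simpa using this

theorem norm_intCast_snd_le (s : ℤ × ℤ) : ‖(s.2 : ℂ)‖ ≤ ‖site s‖ := by
  have := Complex.abs_im_le_norm (site s)
  rw [site_im] at this
  simpa using this

theorem summable_norm_exp_mul {f : ℤ × ℤ → ℂ} (hf : Summable fun s => ‖f s‖) (k : ℝ × ℝ) :
    Summable fun s => ‖Complex.exp (-Complex.I * (kdot k s : ℂ)) * f s‖ := by
  simpa only [norm_mul, norm_exp_kdot, one_mul] using hf

theorem hasSum_fourierSum {f : ℤ × ℤ → ℂ} (hf : Summable fun s => ‖f s‖) (k : ℝ × ℝ) :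
    HasSum (fun s => Complex.exp (-Complex.I * (kdot k s : ℂ)) * f s) (fourierSum f k) :=
  (summable_norm_exp_mul hf k).of_norm.hasSum

theorem continuous_fourierSum {f : ℤ × ℤ → ℂ} (hf : Summable fun s => ‖f s‖) :
    Continuous (fourierSum f) := by
  refine continuous_tsum (fun s => ?_) hf fun s k => ?_
  · unfold kdot
    fun_prop
  · rw [norm_mul, norm_exp_kdot, one_mul]

theorem ExpDecays.hasDerivAt_fst {f : ℤ × ℤ → ℂ} (hf : ExpDecays f) (k : ℝ × ℝ) :
    HasDerivAt (fun t : ℝ => fourierSum f (t, k.2))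
      (fourierSum (fun s => -Complex.I * (s.1 * f s)) k) k.1 := by
  have hg := (hf.mul_of_le (c := fun s => (s.1 : ℂ)) norm_intCast_fst_le).const_mul (-Complex.I)
  refine hasDerivAt_tsum (g := fun s (t : ℝ) =>
    Complex.exp (-Complex.I * (kdot (t, k.2) s : ℂ)) * f s)
    (g' := fun s (t : ℝ) => Complex.exp (-Complex.I * (kdot (t, k.2) s : ℂ)) *
      (-Complex.I * (s.1 * f s))) (y₀ := 0) hg.summable_norm (fun s t => ?_) (fun s t => ?_) ?_ k.1
  · have h1 : HasDerivAt (fun t : ℝ => -Complex.I * ((kdot (t, k.2) s : ℝ) : ℂ))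
        (-Complex.I * (s.1 : ℝ)) t := by
      refine HasDerivAt.const_mul _ (HasDerivAt.ofReal_comp ?_)
      unfold kdot
      simpa using ((hasDerivAt_id t).mul_const (s.1 : ℝ)).add_const (k.2 * (s.2 : ℝ))
    have h2 := (h1.cexp.mul_const (f s))
    refine h2.congr_deriv ?_
    push_cast
    ring
  · rw [norm_mul, norm_exp_kdot, one_mul]
  · exact (hasSum_fourierSum hf.summable_norm (0, k.2)).summable

theorem ExpDecays.hasDerivAt_snd {f : ℤ × ℤ → ℂ} (hf : ExpDecays f) (k : ℝ × ℝ) :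
    HasDerivAt (fun t : ℝ => fourierSum f (k.1, t))
      (fourierSum (fun s => -Complex.I * (s.2 * f s)) k) k.2 := by
  have hg := (hf.mul_of_le (c := fun s => (s.2 : ℂ)) norm_intCast_snd_le).const_mul (-Complex.I)
  refine hasDerivAt_tsum (g := fun s (t : ℝ) =>
    Complex.exp (-Complex.I * (kdot (k.1, t) s : ℂ)) * f s)
    (g' := fun s (t : ℝ) => Complex.exp (-Complex.I * (kdot (k.1, t) s : ℂ)) *
      (-Complex.I * (s.2 * f s))) (y₀ := 0) hg.summable_norm (fun s t => ?_) (fun s t => ?_) ?_ k.2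
  · have h1 : HasDerivAt (fun t : ℝ => -Complex.I * ((kdot (k.1, t) s : ℝ) : ℂ))
        (-Complex.I * (s.2 : ℝ)) t := by
      refine HasDerivAt.const_mul _ (HasDerivAt.ofReal_comp ?_)
      unfold kdot
      simpa using ((hasDerivAt_id t).mul_const (s.2 : ℝ)).const_add (k.1 * (s.1 : ℝ))
    have h2 := (h1.cexp.mul_const (f s))
    refine h2.congr_deriv ?_
    push_cast
    ring
  · rw [norm_mul, norm_exp_kdot, one_mul]
  · exact (hasSum_fourierSum hf.summable_norm (k.1, 0)).summable

/-- The linear form `k ↦ -i k·s`. -/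
def kdotL (s : ℤ × ℤ) : ℝ × ℝ →L[ℝ] ℂ :=
  ((ContinuousLinearMap.fst ℝ ℝ ℝ).smulRight (-Complex.I * s.1)) +
    ((ContinuousLinearMap.snd ℝ ℝ ℝ).smulRight (-Complex.I * s.2))

theorem kdotL_apply (s : ℤ × ℤ) (k : ℝ × ℝ) : kdotL s k = -Complex.I * (kdot k s : ℂ) := by
  simp only [kdotL, kdot, add_apply, ContinuousLinearMap.smulRight_apply,
    ContinuousLinearMap.coe_fst', ContinuousLinearMap.coe_snd', Complex.real_smul]
  push_cast
  ring

theorem norm_kdotL_le (s : ℤ × ℤ) : ‖kdotL s‖ ≤ 2 * ‖site s‖ := by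
  refine ContinuousLinearMap.opNorm_le_bound _ (by positivity) fun k => ?_
  rw [kdotL_apply, norm_mul, norm_neg, Complex.norm_I, one_mul, kdot]
  push_cast
  refine (norm_add_le _ _).trans ?_
  rw [norm_mul, norm_mul, Complex.norm_real, Complex.norm_real]
  have h1 := mul_le_mul (_root_.norm_fst_le k) (norm_intCast_fst_le s) (norm_nonneg _)
    (norm_nonneg _)
  have h2 := mul_le_mul (_root_.norm_snd_le k) (norm_intCast_snd_le s) (norm_nonneg _)
    (norm_nonneg _)
  linarith

/-- The exponential series of each summand converges on a ball of radius `γ / 4` with a bound that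
still decays like `e^{-γ|s|/2}`. -/
theorem ExpDecays.analyticAt_fourierSum {f : ℤ × ℤ → ℂ} (hf : ExpDecays f) (x : ℝ × ℝ) :
    AnalyticAt ℝ (fourierSum f) x := by
  obtain ⟨C, γ, hC, hγ, h⟩ := hf
  set r : NNReal := ⟨γ / 4, by positivity⟩ with hr
  have hrpos : 0 < r := by
    rw [← NNReal.coe_pos]
    change 0 < γ / 4
    positivity
  set c : ℤ × ℤ → ℂ := fun s => Complex.exp (-Complex.I * (kdot x s : ℂ)) * f s
  have hc : ∀ s, ‖c s‖ = ‖f s‖ := fun s => by rw [norm_mul, norm_exp_kdot, one_mul]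
  refine ⟨_, r, hasFPowerSeriesOnBall_tsum (fun s n => c s •
    (((n.factorial : ℝ)⁻¹ • ContinuousMultilinearMap.mkPiAlgebraFin ℝ n ℂ).compContinuousLinearMap
      fun _ => kdotL s)) _ x hrpos
    ((summable_exp_neg_norm_site (half_pos hγ)).mul_left C) (fun s n => ?_) (fun s y => ?_)⟩
  · have h1 : ‖((n.factorial : ℝ)⁻¹ •
        ContinuousMultilinearMap.mkPiAlgebraFin ℝ n ℂ).compContinuousLinearMap
        fun _ => kdotL s‖ ≤ (n.factorial : ℝ)⁻¹ * (2 * ‖site s‖) ^ n := by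
      refine (ContinuousMultilinearMap.norm_compContinuousLinearMap_le _ _).trans ?_
      rw [norm_smul, ContinuousMultilinearMap.norm_mkPiAlgebraFin, mul_one, Finset.prod_const,
        Finset.card_univ, Fintype.card_fin, Real.norm_of_nonneg (by positivity)]
      gcongr
      exact norm_kdotL_le s
    have h2 : (γ / 2 * ‖site s‖) ^ n / n.factorial ≤ Real.exp (γ / 2 * ‖site s‖) :=
      Real.pow_div_factorial_le_exp _ (by positivity) n
    rw [norm_smul, hc]
    calc _ ≤ C * Real.exp (-γ * ‖site s‖) * ((n.factorial : ℝ)⁻¹ * (2 * ‖site s‖) ^ n) *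
          (γ / 4) ^ n := by
          refine mul_le_mul_of_nonneg_right ?_ (by positivity)
          exact mul_le_mul (h s) h1 (norm_nonneg _) (by positivity)
      _ = C * Real.exp (-γ * ‖site s‖) * ((γ / 2 * ‖site s‖) ^ n / n.factorial) := by
          have : γ / 2 * ‖site s‖ = 2 * ‖site s‖ * (γ / 4) := by ring
          rw [this, mul_pow (2 * ‖site s‖)]
          ring
      _ ≤ C * Real.exp (-γ * ‖site s‖) * Real.exp (γ / 2 * ‖site s‖) := by gcongr
      _ = _ := by
          rw [mul_assoc, ← Real.exp_add]
          congr 2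
          ring
  · have h1 := (NormedSpace.exp_series_hasSum_exp' (𝕂 := ℝ) (kdotL s y)).mul_left (c s)
    have h2 : c s * NormedSpace.exp (kdotL s y) =
        Complex.exp (-Complex.I * (kdot (x + y) s : ℂ)) * f s := by
      rw [← Complex.exp_eq_exp_ℂ, kdotL_apply, mul_right_comm, ← Complex.exp_add]
      congr 2
      simp only [kdot, Prod.fst_add, Prod.snd_add]
      push_cast
      ring
    rw [h2] at h1
    refine h1.congr_fun fun n => ?_
    simp

end

section

/-! ### The Bloch fibres of a localized projector -/

variable {K : ℕ} {P : H K →L[ℂ] H K}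

theorem blochFiber_apply (P : H K →L[ℂ] H K) (k : ℝ × ℝ) (α β : Fin K) :
    blochFiber P k α β = fourierSum (fun s => hop P s α β) k := by
  simp only [blochFiber, fourierSum, Matrix.of_apply, hop_apply, entry_eq_inner]
  rfl

theorem IsLocalizedProjector.expDecays_hop (hP : IsLocalizedProjector P) (α β : Fin K) :
    ExpDecays fun s => hop P s α β := by
  obtain ⟨C, γ, hC, hγ, h⟩ := hP.decays
  refine ⟨C, γ, hC, hγ, fun s => ?_⟩
  have := h (s, α) (0, β)
  rwa [site_zero, sub_zero, pow_zero, mul_one] at this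

theorem IsLocalizedProjector.hasSum_blochFiber (hP : IsLocalizedProjector P) (k : ℝ × ℝ)
    (α β : Fin K) : HasSum (fun s => Complex.exp (-Complex.I * (kdot k s : ℂ)) * hop P s α β)
      (blochFiber P k α β) := by
  rw [blochFiber_apply]
  exact hasSum_fourierSum (hP.expDecays_hop α β).summable_norm k

theorem exp_kdot_add (k : ℝ × ℝ) (s t : ℤ × ℤ) :
    Complex.exp (-Complex.I * (kdot k (s + t) : ℂ)) =
      Complex.exp (-Complex.I * (kdot k s : ℂ)) * Complex.exp (-Complex.I * (kdot k t : ℂ)) := by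
  rw [← Complex.exp_add]
  congr 1
  simp only [kdot, Prod.fst_add, Prod.snd_add]
  push_cast
  ring

theorem star_exp_kdot (k : ℝ × ℝ) (s : ℤ × ℤ) :
    star (Complex.exp (-Complex.I * (kdot k s : ℂ))) =
      Complex.exp (-Complex.I * (kdot k (-s) : ℂ)) := by
  rw [Complex.star_def, ← Complex.exp_conj]
  congr 1
  simp only [map_mul, map_neg, Complex.conj_I, Complex.conj_ofReal, kdot, Prod.fst_neg,
    Prod.snd_neg]
  push_cast
  ring

/-- `P² = P` as a convolution identity for the hopping matrices. -/
theorem IsLocalizedProjector.hasSum_hop_mul_hop (hP : IsLocalizedProjector P) (n : ℤ × ℤ)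
    (α β : Fin K) :
    HasSum (fun m => ∑ δ, hop P (n - m) α δ * hop P m δ β) (hop P n α β) := by
  have h := hasSum_entry_mul P P (n, α) (0, β)
  rw [hP.mul_self] at h
  refine h.prod_fiberwise fun m => ?_
  refine hasSum_of_eq (hasSum_fintype _) ?_
  refine Finset.sum_congr rfl fun δ _ => ?_
  simp only [hP.entry_eq_hop (n, α), hop_apply]

/-- The shear `(s, t) ↦ (s - t, t)` of pairs of lattice points. -/
def shear : (ℤ × ℤ) × (ℤ × ℤ) ≃ (ℤ × ℤ) × (ℤ × ℤ) where
  toFun q := (q.1 - q.2, q.2)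
  invFun q := (q.1 + q.2, q.2)
  left_inv q := by simp
  right_inv q := by simp

theorem hasSum_mul_of_summable_norm {ι κ : Type*} {f : ι → ℂ} {g : κ → ℂ} {a b : ℂ}
    (hf : HasSum f a) (hg : HasSum g b) (sf : Summable fun i => ‖f i‖)
    (sg : Summable fun i => ‖g i‖) : HasSum (fun q : ι × κ => f q.1 * g q.2) (a * b) := by
  have h : Summable fun q : ι × κ => f q.1 * g q.2 := summable_mul_of_summable_norm sf sg
  exact hf.mul hg h

/-- A matrix-valued sequence that is idempotent under convolution has an idempotent transform, for
every character `e` of the lattice. -/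
theorem mul_self_of_convolution {e : ℤ × ℤ → ℂ} (he : ∀ s t, e (s + t) = e s * e t)
    {p : ℤ × ℤ → Matrix (Fin K) (Fin K) ℂ} {A : Matrix (Fin K) (Fin K) ℂ}
    (hA : ∀ α β, HasSum (fun s => e s * p s α β) (A α β))
    (hs : ∀ α β, Summable fun s => ‖e s * p s α β‖)
    (hp : ∀ n α β, HasSum (fun m => ∑ δ, p (n - m) α δ * p m δ β) (p n α β)) :
    A * A = A := by
  ext α β
  rw [Matrix.mul_apply]
  have h0 : ∀ δ, HasSum (fun q : (ℤ × ℤ) × (ℤ × ℤ) =>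
      (e q.1 * p q.1 α δ) * (e q.2 * p q.2 δ β)) (A α δ * A δ β) := fun δ =>
    hasSum_mul_of_summable_norm (f := fun s => e s * p s α δ) (g := fun s => e s * p s δ β)
      (hA α δ) (hA δ β) (hs α δ) (hs δ β)
  have h1 : HasSum (fun q : (ℤ × ℤ) × (ℤ × ℤ) =>
      ∑ δ, (e q.1 * p q.1 α δ) * (e q.2 * p q.2 δ β)) (∑ δ, A α δ * A δ β) :=
    hasSum_sum fun δ _ => h0 δ
  have h2 : HasSum (fun q : (ℤ × ℤ) × (ℤ × ℤ) =>
      ∑ δ, (e (q.1 - q.2) * p (q.1 - q.2) α δ) * (e q.2 * p q.2 δ β)) (∑ δ, A α δ * A δ β) := by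
    have h := shear.hasSum_iff.mpr h1
    exact h
  have h3 : ∀ n : ℤ × ℤ, HasSum (fun m : ℤ × ℤ =>
      ∑ δ, (e (n - m) * p (n - m) α δ) * (e m * p m δ β)) (e n * p n α β) := by
    intro n
    have h5 : (fun m : ℤ × ℤ => ∑ δ, (e (n - m) * p (n - m) α δ) * (e m * p m δ β)) =
        fun m => e n * ∑ δ, p (n - m) α δ * p m δ β := by
      ext m
      rw [Finset.mul_sum]
      refine Finset.sum_congr rfl fun δ _ => ?_
      have h4 := he (n - m) m
      rw [sub_add_cancel] at h4
      rw [h4]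
      ring
    rw [h5]
    exact (hp n α β).mul_left (e n)
  exact (h2.prod_fiberwise h3).unique (hA α β)

theorem IsLocalizedProjector.blochFiber_mul_self (hP : IsLocalizedProjector P)
    (k : ℝ × ℝ) : blochFiber P k * blochFiber P k = blochFiber P k :=
  mul_self_of_convolution (exp_kdot_add k) (hP.hasSum_blochFiber k)
    (fun α β => summable_norm_exp_mul (hP.expDecays_hop α β).summable_norm k)
    hP.hasSum_hop_mul_hop

theorem IsLocalizedProjector.star_hop_neg (hP : IsLocalizedProjector P) (s : ℤ × ℤ)
    (α β : Fin K) : star (hop P (-s) β α) = hop P s α β := by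
  have h4 := entry_adjoint P (0, α) (-s, β)
  rw [← ContinuousLinearMap.star_eq_adjoint, hP.star_eq, hP.entry_eq_hop] at h4
  simp only [sub_neg_eq_add, zero_add] at h4
  exact h4.symm

theorem IsLocalizedProjector.star_blochFiber (hP : IsLocalizedProjector P)
    (k : ℝ × ℝ) : star (blochFiber P k) = blochFiber P k := by
  ext α β
  rw [Matrix.star_apply]
  have h1 := (hP.hasSum_blochFiber k β α).star
  have h2 := (Equiv.neg (ℤ × ℤ)).hasSum_iff.mpr h1
  refine (h2.congr_fun fun s => ?_).unique (hP.hasSum_blochFiber k α β)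
  simp only [Function.comp_apply, Equiv.neg_apply, star_mul, star_exp_kdot, neg_neg]
  rw [hP.star_hop_neg, mul_comm]

theorem IsLocalizedProjector.isStarProjection_blochFiber (hP : IsLocalizedProjector P)
    (k : ℝ × ℝ) : IsStarProjection (blochFiber P k) :=
  ⟨hP.blochFiber_mul_self k, hP.star_blochFiber k⟩

theorem IsLocalizedProjector.analyticOnNhd_blochFiber (hP : IsLocalizedProjector P)
    (α β : Fin K) :
    AnalyticOnNhd ℝ (fun k : ℝ × ℝ => blochFiber P k α β) Set.univ := by
  intro k _
  have h := (hP.expDecays_hop α β).analyticAt_fourierSum k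
  have e : (fun k : ℝ × ℝ => blochFiber P k α β) = fourierSum fun s => hop P s α β := by
    ext k
    exact blochFiber_apply P k α β
  rw [e]
  exact h

/-! ### The Bloch decomposition -/

open MeasureTheory

/-- If a sequence converges in `L²` and also pointwise almost everywhere, the two limits agree. -/
theorem ae_eq_of_tendsto_Lp {α E : Type*} [MeasurableSpace α] {μ : Measure α}
    [NormedAddCommGroup E] {G : ℕ → Lp E 2 μ} {G' : Lp E 2 μ} {g : ℕ → α → E} {g' : α → E}
    (hG : Filter.Tendsto G Filter.atTop (nhds G')) (hg : ∀ n, G n =ᵐ[μ] g n)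
    (hlim : ∀ᵐ x ∂μ, Filter.Tendsto (fun n => g n x) Filter.atTop (nhds (g' x))) :
    G' =ᵐ[μ] g' := by
  obtain ⟨φ, hφ, hae⟩ := (tendstoInMeasure_of_tendsto_Lp hG).exists_seq_tendsto_ae
  filter_upwards [hae, hlim, ae_all_iff.mpr hg] with x hx hx' hgx
  refine tendsto_nhds_unique hx ((hx'.comp hφ.tendsto_atTop).congr fun n => ?_)
  exact (hgx (φ n)).symm

/-- Fibrewise relations `G = A H` pass to limits in `L²`. -/
theorem ae_eq_apply_of_tendsto_Lp {α E : Type*} [MeasurableSpace α] {μ : Measure α}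
    [NormedAddCommGroup E] {G T : ℕ → Lp E 2 μ} {G' T' : Lp E 2 μ} {A : α → E → E}
    (hA : ∀ x, Continuous (A x))
    (hG : Filter.Tendsto G Filter.atTop (nhds G')) (hT : Filter.Tendsto T Filter.atTop (nhds T'))
    (h : ∀ n, ∀ᵐ x ∂μ, G n x = A x (T n x)) : ∀ᵐ x ∂μ, G' x = A x (T' x) := by
  obtain ⟨φ, hφ, hae⟩ := (tendstoInMeasure_of_tendsto_Lp hT).exists_seq_tendsto_ae
  refine ae_eq_of_tendsto_Lp (hG.comp hφ.tendsto_atTop) (g := fun n x => A x (T (φ n) x))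
    (fun n => h (φ n)) ?_
  filter_upwards [hae] with x hx
  exact ((hA x).tendsto _).comp hx

theorem hasSum_smul_single {ι : Type*} [DecidableEq ι] (ψ : Ell2 ι) :
    HasSum (fun x => ψ x • (lp.single 2 x (1 : ℂ) : Ell2 ι)) ψ := by
  refine (lp.hasSum_single (p := 2) (by norm_num) ψ).congr_fun fun x => ?_
  rw [← lp.single_smul]
  simp

theorem hasSum_prod_of_fintype {ι κ M : Type*} [Fintype κ] [AddCommMonoid M]
    [TopologicalSpace M] [ContinuousAdd M] {f : ι × κ → M} {a : κ → M}
    (h : ∀ j, HasSum (fun i => f (i, j)) (a j)) : HasSum f (∑ j, a j) := by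
  classical
  have h1 : ∀ j, HasSum (fun x : ι × κ => if x.2 = j then f x else 0) (a j) := by
    intro j
    have hinj : Function.Injective fun i : ι => (i, j) := fun _ _ h => congrArg Prod.fst h
    refine (hinj.hasSum_iff fun x hx => ?_).mp ((h j).congr_fun fun i => ?_)
    · rw [if_neg]
      rintro rfl
      exact hx ⟨x.1, rfl⟩
    · simp
  refine (hasSum_sum fun j (_ : j ∈ Finset.univ) => h1 j).congr_fun fun x => ?_
  simp

/-- The fibre acts on a Bloch wave as `P` acts on the corresponding basis vector. -/
theorem IsLocalizedProjector.hasSum_entry_smul_blochWaveFun (hP : IsLocalizedProjector P)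
    (m : ℤ × ℤ) (β : Fin K) (k : ℝ × ℝ) :
    HasSum (fun x : (ℤ × ℤ) × Fin K => entry P x (m, β) • blochWaveFun x.1 x.2 k)
      (Matrix.toEuclideanLin (blochFiber P k) (blochWaveFun m β k)) := by
  set e : ℤ × ℤ → ℂ := fun s => Complex.exp (-Complex.I * (kdot k s : ℂ)) with he
  have h1 : ∀ α, HasSum (fun n : ℤ × ℤ => entry P (n, α) (m, β) • blochWaveFun n α k)
      ((blochFiber P k α β * ((1 / (2 * Real.pi) : ℂ) * e m)) •
        EuclideanSpace.single α (1 : ℂ)) := by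
    intro α
    have h2 := ((hP.hasSum_blochFiber k α β).mul_right
      ((1 / (2 * Real.pi) : ℂ) * e m)).smul_const (EuclideanSpace.single α (1 : ℂ))
    have h3 := (Equiv.subRight m).hasSum_iff.mpr h2
    refine h3.congr_fun fun n => ?_
    simp only [Function.comp_apply, Equiv.subRight_apply, blochWaveFun, hP.entry_eq_hop (n, α),
      smul_smul]
    congr 1
    have h4 : e n = e (n - m) * e m := by
      rw [he]
      simp only
      rw [← exp_kdot_add, sub_add_cancel]
    change hop P (n - m) α β * ((1 / (2 * Real.pi) : ℂ) * e n) =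
      e (n - m) * hop P (n - m) α β * ((1 / (2 * Real.pi) : ℂ) * e m)
    rw [h4]
    ring
  have h5 : Matrix.toEuclideanLin (blochFiber P k) (blochWaveFun m β k) =
      ∑ α, (blochFiber P k α β * ((1 / (2 * Real.pi) : ℂ) * e m)) •
        EuclideanSpace.single α (1 : ℂ) := by
    rw [blochWaveFun, map_smul]
    ext γ
    simp [Pi.single_apply, he]
    ring
  rw [h5]
  exact hasSum_prod_of_fintype h1

/-- The relation is checked on basis vectors, where it is a Fourier series that converges pointwise,
and extends to all of `H K` because it passes to linear combinations and to limits in `L²`. -/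
theorem IsLocalizedProjector.isBlochDecomposition (hP : IsLocalizedProjector P) :
    IsBlochDecomposition P (blochFiber P) := by
  have hcont : ∀ k, Continuous fun v : EuclideanSpace ℂ (Fin K) =>
      Matrix.toEuclideanLin (blochFiber P k) v := fun k =>
    LinearMap.continuous_of_finiteDimensional _
  obtain ⟨u, hu⟩ := Filter.exists_seq_tendsto
    (Filter.atTop : Filter (Finset ((ℤ × ℤ) × Fin K)))
  have hwave : ∀ x : (ℤ × ℤ) × Fin K, bloch K (lp.single 2 x (1 : ℂ)) = blochWave x :=
    fun x => bloch_ket x.1 x.2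
  have hwave_ae : ∀ x : (ℤ × ℤ) × Fin K, (blochWave x : ℝ × ℝ → EuclideanSpace ℂ (Fin K))
      =ᵐ[volume.restrict brillouin] blochWaveFun x.1 x.2 :=
    fun x => (memLp_blochWaveFun x.1 x.2).coeFn_toLp
  have hket : ∀ y : (ℤ × ℤ) × Fin K, ∀ᵐ k ∂(volume.restrict brillouin),
      (bloch K (P (lp.single 2 y (1 : ℂ))) : ℝ × ℝ → EuclideanSpace ℂ (Fin K)) k =
      Matrix.toEuclideanLin (blochFiber P k)
        ((blochWave y : ℝ × ℝ → EuclideanSpace ℂ (Fin K)) k) := by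
    intro y
    have h1 := (hasSum_entry_smul P y).mapL (bloch K).toContinuousLinearMap
    have h2 := h1.comp hu
    have h3 : bloch K (P (lp.single 2 y (1 : ℂ))) =ᵐ[volume.restrict brillouin]
        fun k => Matrix.toEuclideanLin (blochFiber P k) (blochWaveFun y.1 y.2 k) := by
      refine ae_eq_of_tendsto_Lp h2
        (g := fun n k => ∑ x ∈ u n, entry P x y • blochWaveFun x.1 x.2 k) (fun n => ?_) ?_
      · have hw := ae_all_iff.mpr hwave_ae
        have hsm := ae_all_iff.mpr fun x : (ℤ × ℤ) × Fin K =>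
          Lp.coeFn_smul (entry P x y) (blochWave x)
        have e : ((fun s => ∑ x ∈ s, (bloch K).toContinuousLinearMap
            (entry P x y • (lp.single 2 x (1 : ℂ) : H K))) ∘ u) n =
            ∑ x ∈ u n, entry P x y • blochWave x := by
          refine Finset.sum_congr rfl fun x _ => ?_
          rw [map_smul]
          congr 1
          exact hwave x
        rw [e]
        filter_upwards [Lp.coeFn_finsetSum (u n) fun x => entry P x y • blochWave x, hw, hsm]
          with k hk hwk hsk
        rw [hk, Finset.sum_apply]
        refine Finset.sum_congr rfl fun x _ => ?_
        rw [hsk x, Pi.smul_apply, hwk x]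
      · exact Filter.Eventually.of_forall fun k =>
          (hP.hasSum_entry_smul_blochWaveFun y.1 y.2 k).comp hu
    filter_upwards [h3, hwave_ae y] with k hk hk'
    rw [hk, hk']
  intro ψ
  have h1 := hasSum_smul_single ψ
  have hT := (h1.mapL (bloch K).toContinuousLinearMap).comp hu
  have hG := ((h1.mapL P).mapL (bloch K).toContinuousLinearMap).comp hu
  refine ae_eq_apply_of_tendsto_Lp hcont hG hT fun n => ?_
  have e1 : ((fun s => ∑ x ∈ s, (bloch K).toContinuousLinearMap
      (ψ x • (lp.single 2 x (1 : ℂ) : H K))) ∘ u) n = ∑ x ∈ u n, ψ x • blochWave x := by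
    refine Finset.sum_congr rfl fun x _ => ?_
    rw [map_smul]
    congr 1
    exact hwave x
  have e2 : ((fun s => ∑ x ∈ s, (bloch K).toContinuousLinearMap
      (P (ψ x • (lp.single 2 x (1 : ℂ) : H K)))) ∘ u) n =
      ∑ x ∈ u n, ψ x • bloch K (P (lp.single 2 x (1 : ℂ))) := by
    refine Finset.sum_congr rfl fun x _ => ?_
    rw [map_smul, map_smul]
    rfl
  rw [e1, e2]
  have hsm1 := ae_all_iff.mpr fun x : (ℤ × ℤ) × Fin K => Lp.coeFn_smul (ψ x) (blochWave x)
  have hsm2 := ae_all_iff.mpr fun x : (ℤ × ℤ) × Fin K =>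
    Lp.coeFn_smul (ψ x) (bloch K (P (lp.single 2 x (1 : ℂ))))
  filter_upwards [Lp.coeFn_finsetSum (u n) fun x => ψ x • blochWave x,
    Lp.coeFn_finsetSum (u n) fun x => ψ x • bloch K (P (lp.single 2 x (1 : ℂ))), hsm1, hsm2,
    ae_all_iff.mpr hket] with k hk1 hk2 hs1 hs2 hk
  rw [hk1, hk2, Finset.sum_apply, Finset.sum_apply, map_sum]
  refine Finset.sum_congr rfl fun x _ => ?_
  rw [hs1 x, hs2 x, Pi.smul_apply, Pi.smul_apply, map_smul, hk x]

end

section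

/-! ### The Chern number as a lattice sum -/

open MeasureTheory

variable {K : ℕ} {P : H K →L[ℂ] H K}

theorem setIntegral_exp_kdot (s : ℤ × ℤ) :
    ∫ k in brillouin, Complex.exp (-Complex.I * (kdot k s : ℂ)) =
      if s = 0 then (2 * Real.pi : ℂ) ^ 2 else 0 := by
  have key : ∀ k : ℝ × ℝ, Complex.exp (-Complex.I * (kdot k s : ℂ)) =
      Complex.exp (Complex.I * ((-s.1 : ℤ) : ℂ) * k.1) *
        Complex.exp (Complex.I * ((-s.2 : ℤ) : ℂ) * k.2) := by
    intro k
    rw [← Complex.exp_add]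
    congr 1
    unfold kdot
    push_cast
    ring
  simp only [key]
  rw [brillouin, Measure.volume_eq_prod,
    setIntegral_prod_mul (μ := volume) (ν := volume)
      (fun t : ℝ => Complex.exp (Complex.I * ((-s.1 : ℤ) : ℂ) * t))
      (fun t : ℝ => Complex.exp (Complex.I * ((-s.2 : ℤ) : ℂ) * t)),
    setIntegral_exp, setIntegral_exp]
  by_cases h1 : s.1 = 0 <;> by_cases h2 : s.2 = 0 <;> simp [h1, h2, Prod.ext_iff]
  ring

theorem hasSum_fourierSum_mul {f g h : ℤ × ℤ → ℂ} (hf : Summable fun s => ‖f s‖)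
    (hg : Summable fun s => ‖g s‖) (hh : Summable fun s => ‖h s‖) (k : ℝ × ℝ) :
    HasSum (fun q : (ℤ × ℤ) × ((ℤ × ℤ) × (ℤ × ℤ)) =>
      Complex.exp (-Complex.I * (kdot k (q.1 + (q.2.1 + q.2.2)) : ℂ)) *
        (f q.1 * (g q.2.1 * h q.2.2)))
      (fourierSum f k * (fourierSum g k * fourierSum h k)) := by
  have sf := summable_norm_exp_mul hf k
  have sg := summable_norm_exp_mul hg k
  have sh := summable_norm_exp_mul hh k
  have h1 := hasSum_mul_of_summable_norm (hasSum_fourierSum hg k) (hasSum_fourierSum hh k) sg sh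
  have s1 := sg.mul_norm sh
  have h2 := hasSum_mul_of_summable_norm (hasSum_fourierSum hf k) h1 sf s1
  have e : (fun q : (ℤ × ℤ) × ((ℤ × ℤ) × (ℤ × ℤ)) =>
      Complex.exp (-Complex.I * (kdot k (q.1 + (q.2.1 + q.2.2)) : ℂ)) *
        (f q.1 * (g q.2.1 * h q.2.2))) = fun q =>
      (Complex.exp (-Complex.I * (kdot k q.1 : ℂ)) * f q.1) *
        ((Complex.exp (-Complex.I * (kdot k q.2.1 : ℂ)) * g q.2.1) *
          (Complex.exp (-Complex.I * (kdot k q.2.2 : ℂ)) * h q.2.2)) := by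
    ext q
    rw [exp_kdot_add, exp_kdot_add]
    ring
  rw [e]
  exact h2

/-- The integral of a product of three Fourier series is the sum of the products of coefficients
over triples of lattice points that add up to zero. -/
theorem hasSum_integral_fourierSum_mul {f g h : ℤ × ℤ → ℂ} (hf : Summable fun s => ‖f s‖)
    (hg : Summable fun s => ‖g s‖) (hh : Summable fun s => ‖h s‖) :
    HasSum (fun q : (ℤ × ℤ) × (ℤ × ℤ) =>
      (2 * Real.pi : ℂ) ^ 2 * (f (-(q.1 + q.2)) * (g q.1 * h q.2)))
      (∫ k in brillouin, fourierSum f k * (fourierSum g k * fourierSum h k)) := by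
  let F : (ℤ × ℤ) × ((ℤ × ℤ) × (ℤ × ℤ)) → ℝ × ℝ → ℂ := fun q k =>
    Complex.exp (-Complex.I * (kdot k (q.1 + (q.2.1 + q.2.2)) : ℂ)) *
      (f q.1 * (g q.2.1 * h q.2.2))
  have hF : ∀ q, Integrable (F q) (volume.restrict brillouin) := by
    intro q
    have hc : Continuous (F q) := by
      simp only [F]
      unfold kdot
      fun_prop
    exact hc.continuousOn.integrableOn_compact isCompact_brillouin
  have hnorm : ∀ q k, ‖F q k‖ = ‖f q.1 * (g q.2.1 * h q.2.2)‖ := by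
    intro q k
    simp only [F]
    rw [norm_mul, norm_exp_kdot, one_mul]
  have hs : Summable fun q => ∫ k in brillouin, ‖F q k‖ := by
    simp only [hnorm, integral_const]
    exact (hf.mul_norm (hg.mul_norm hh)).const_smul _
  have h1 := hasSum_integral_of_summable_integral_norm hF hs
  have e1 : (∫ k in brillouin, ∑' q, F q k) =
      ∫ k in brillouin, fourierSum f k * (fourierSum g k * fourierSum h k) := by
    congr 1
    ext k
    exact (hasSum_fourierSum_mul hf hg hh k).tsum_eq
  rw [e1] at h1
  have hinj : Function.Injective fun q : (ℤ × ℤ) × (ℤ × ℤ) => (-(q.1 + q.2), q) :=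
    fun _ _ h => congrArg Prod.snd h
  have hint : ∀ q, ∫ k in brillouin, F q k =
      (if q.1 + (q.2.1 + q.2.2) = 0 then (2 * Real.pi : ℂ) ^ 2 else 0) *
        (f q.1 * (g q.2.1 * h q.2.2)) := by
    intro q
    simp only [F]
    rw [integral_mul_const, setIntegral_exp_kdot]
  simp only [hint] at h1
  have h2 := (hinj.hasSum_iff (fun q hq => ?_)).mpr h1
  · have e2 : (fun q : (ℤ × ℤ) × (ℤ × ℤ) =>
        (2 * Real.pi : ℂ) ^ 2 * (f (-(q.1 + q.2)) * (g q.1 * h q.2))) =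
        (fun q : (ℤ × ℤ) × ((ℤ × ℤ) × (ℤ × ℤ)) =>
          (if q.1 + (q.2.1 + q.2.2) = 0 then (2 * Real.pi : ℂ) ^ 2 else 0) *
            (f q.1 * (g q.2.1 * h q.2.2))) ∘ fun q => (-(q.1 + q.2), q) := by
      ext q
      simp only [Function.comp_apply, neg_add_cancel, if_true]
    rw [e2]
    exact h2
  · rw [if_neg, zero_mul]
    intro h0
    refine hq ⟨q.2, Prod.ext ?_ rfl⟩
    exact (eq_neg_of_add_eq_zero_left h0).symm

theorem IsLocalizedProjector.dk1_blochFiber (hP : IsLocalizedProjector P) (k : ℝ × ℝ)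
    (α β : Fin K) :
    dk1 (blochFiber P) k α β = fourierSum (fun s => -Complex.I * (s.1 * hop P s α β)) k := by
  have h := ((hP.expDecays_hop α β).hasDerivAt_fst k).deriv
  rw [← h, dk1, Matrix.of_apply]
  simp only [blochFiber_apply]

theorem IsLocalizedProjector.dk2_blochFiber (hP : IsLocalizedProjector P) (k : ℝ × ℝ)
    (α β : Fin K) :
    dk2 (blochFiber P) k α β = fourierSum (fun s => -Complex.I * (s.2 * hop P s α β)) k := by
  have h := ((hP.expDecays_hop α β).hasDerivAt_snd k).deriv
  rw [← h, dk2, Matrix.of_apply]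
  simp only [blochFiber_apply]

theorem integrable_fourierSum_mul {f g h : ℤ × ℤ → ℂ} (hf : Summable fun s => ‖f s‖)
    (hg : Summable fun s => ‖g s‖) (hh : Summable fun s => ‖h s‖) :
    Integrable (fun k => fourierSum f k * (fourierSum g k * fourierSum h k))
      (volume.restrict brillouin) :=
  ((continuous_fourierSum hf).mul ((continuous_fourierSum hg).mul
    (continuous_fourierSum hh))).continuousOn.integrableOn_compact isCompact_brillouin

theorem trace_mul_mul {A B C : Matrix (Fin K) (Fin K) ℂ} :
    (A * B * C).trace = ∑ α, ∑ β, ∑ δ, A α β * (B β δ * C δ α) := by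
  rw [mul_assoc]
  simp only [Matrix.trace, Matrix.diag, Matrix.mul_apply, Finset.mul_sum]

/-- The Chern number is the lattice sum that computes minus the index. -/
theorem IsLocalizedProjector.chernNumber_blochFiber (hP : IsLocalizedProjector P) :
    chernNumber (blochFiber P) = -(index (fluxCompression P) : ℂ) := by
  let p : Fin K → Fin K → ℤ × ℤ → ℂ := fun α β s => hop P s α β
  let p1 : Fin K → Fin K → ℤ × ℤ → ℂ := fun α β s => -Complex.I * (s.1 * hop P s α β)
  let p2 : Fin K → Fin K → ℤ × ℤ → ℂ := fun α β s => -Complex.I * (s.2 * hop P s α β)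
  have sp : ∀ α β, Summable fun s => ‖p α β s‖ := fun α β => (hP.expDecays_hop α β).summable_norm
  have sp1 : ∀ α β, Summable fun s => ‖p1 α β s‖ := fun α β =>
    (((hP.expDecays_hop α β).mul_of_le (c := fun s => (s.1 : ℂ))
      norm_intCast_fst_le).const_mul (-Complex.I)).summable_norm
  have sp2 : ∀ α β, Summable fun s => ‖p2 α β s‖ := fun α β =>
    (((hP.expDecays_hop α β).mul_of_le (c := fun s => (s.2 : ℂ))
      norm_intCast_snd_le).const_mul (-Complex.I)).summable_norm
  have htr : ∀ k, (blochFiber P k * (dk1 (blochFiber P) k * dk2 (blochFiber P) k -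
      dk2 (blochFiber P) k * dk1 (blochFiber P) k)).trace =
      ∑ α, ∑ β, ∑ δ, (fourierSum (p α β) k * (fourierSum (p1 β δ) k * fourierSum (p2 δ α) k) -
        fourierSum (p α β) k * (fourierSum (p2 β δ) k * fourierSum (p1 δ α) k)) := by
    intro k
    rw [mul_sub, Matrix.trace_sub, ← mul_assoc, ← mul_assoc, trace_mul_mul, trace_mul_mul]
    simp only [← Finset.sum_sub_distrib, hP.dk1_blochFiber, hP.dk2_blochFiber, blochFiber_apply]
    rfl
  have hI1 : ∀ α β δ, Integrable (fun k => fourierSum (p α β) k *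
      (fourierSum (p1 β δ) k * fourierSum (p2 δ α) k)) (volume.restrict brillouin) :=
    fun α β δ => integrable_fourierSum_mul (sp α β) (sp1 β δ) (sp2 δ α)
  have hI2 : ∀ α β δ, Integrable (fun k => fourierSum (p α β) k *
      (fourierSum (p2 β δ) k * fourierSum (p1 δ α) k)) (volume.restrict brillouin) :=
    fun α β δ => integrable_fourierSum_mul (sp α β) (sp2 β δ) (sp1 δ α)
  have hsum : HasSum (fun q : (ℤ × ℤ) × (ℤ × ℤ) => ∑ α, ∑ β, ∑ δ,
      ((2 * Real.pi : ℂ) ^ 2 * (p α β (-(q.1 + q.2)) * (p1 β δ q.1 * p2 δ α q.2)) -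
        (2 * Real.pi : ℂ) ^ 2 * (p α β (-(q.1 + q.2)) * (p2 β δ q.1 * p1 δ α q.2))))
      (∫ k in brillouin, (blochFiber P k * (dk1 (blochFiber P) k * dk2 (blochFiber P) k -
        dk2 (blochFiber P) k * dk1 (blochFiber P) k)).trace) := by
    have e : (∫ k in brillouin, (blochFiber P k * (dk1 (blochFiber P) k * dk2 (blochFiber P) k -
        dk2 (blochFiber P) k * dk1 (blochFiber P) k)).trace) = ∑ α, ∑ β, ∑ δ,
        ((∫ k in brillouin, fourierSum (p α β) k *
            (fourierSum (p1 β δ) k * fourierSum (p2 δ α) k)) -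
          ∫ k in brillouin, fourierSum (p α β) k *
            (fourierSum (p2 β δ) k * fourierSum (p1 δ α) k)) := by
      simp only [htr]
      have hI : ∀ α β δ, Integrable (fun k => fourierSum (p α β) k *
          (fourierSum (p1 β δ) k * fourierSum (p2 δ α) k) - fourierSum (p α β) k *
            (fourierSum (p2 β δ) k * fourierSum (p1 δ α) k)) (volume.restrict brillouin) :=
        fun α β δ => (hI1 α β δ).sub (hI2 α β δ)
      rw [integral_finsetSum _ fun α _ => integrable_finsetSum _ fun β _ =>
        integrable_finsetSum _ fun δ _ => hI α β δ]
      refine Finset.sum_congr rfl fun α _ => ?_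
      rw [integral_finsetSum _ fun β _ => integrable_finsetSum _ fun δ _ => hI α β δ]
      refine Finset.sum_congr rfl fun β _ => ?_
      rw [integral_finsetSum _ fun δ _ => hI α β δ]
      exact Finset.sum_congr rfl fun δ _ => integral_sub (hI1 α β δ) (hI2 α β δ)
    rw [e]
    refine hasSum_sum fun α _ => hasSum_sum fun β _ => hasSum_sum fun δ _ => ?_
    exact (hasSum_integral_fourierSum_mul (sp α β) (sp1 β δ) (sp2 δ α)).sub
      (hasSum_integral_fourierSum_mul (sp α β) (sp2 β δ) (sp1 δ α))
  have h2 := hsum.mul_left (1 / (2 * Real.pi * Complex.I))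
  refine HasSum.unique (hasSum_of_eq h2 rfl) ?_
  have e : (fun q : (ℤ × ℤ) × (ℤ × ℤ) => 1 / (2 * Real.pi * Complex.I) * ∑ α, ∑ β, ∑ δ,
      ((2 * Real.pi : ℂ) ^ 2 * (p α β (-(q.1 + q.2)) * (p1 β δ q.1 * p2 δ α q.2)) -
        (2 * Real.pi : ℂ) ^ 2 * (p α β (-(q.1 + q.2)) * (p2 β δ q.1 * p1 δ α q.2)))) =
      fun q : (ℤ × ℤ) × (ℤ × ℤ) => (hop P (-(q.1 + q.2)) * hop P q.1 * hop P q.2).trace *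
        (2 * Real.pi * Complex.I * (q.1.1 * q.2.2 - q.1.2 * q.2.1)) := by
    ext q
    rw [trace_mul_mul]
    simp only [Finset.sum_mul, Finset.mul_sum]
    refine Finset.sum_congr rfl fun α _ => Finset.sum_congr rfl fun β _ =>
      Finset.sum_congr rfl fun δ _ => ?_
    simp only [p, p1, p2]
    have hpi : (Real.pi : ℂ) ≠ 0 := by exact_mod_cast Real.pi_ne_zero
    field_simp
  rw [e]
  exact hP.hasSum_hop

end

section

/-! ### Homotopy invariance -/

variable {K : ℕ}

theorem continuous_fluxCompression :
    Continuous (fluxCompression : (H K →L[ℂ] H K) → (H K →L[ℂ] H K)) := by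
  unfold fluxCompression
  exact (continuous_id.clm_comp (continuous_const.clm_comp continuous_id)).add
    (continuous_const.sub continuous_id)

/-- The index is constant along a norm-continuous path of localized projectors, because it is
locally constant on Fredholm operators and an interval is connected. -/
theorem index_fluxCompression_eq_of_continuousOn {a b : ℝ} {P : ℝ → (H K →L[ℂ] H K)}
    (hc : ContinuousOn P (Set.Icc a b))
    (hP : ∀ τ ∈ Set.Icc a b, IsLocalizedProjector (P τ)) {s t : ℝ}
    (hs : s ∈ Set.Icc a b) (ht : t ∈ Set.Icc a b) :
    index (fluxCompression (P s)) = index (fluxCompression (P t)) := by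
  have hF : ContinuousOn (fun τ => fluxCompression (P τ)) (Set.Icc a b) :=
    continuous_fluxCompression.comp_continuousOn hc
  have hI : ContinuousOn (fun τ => index (fluxCompression (P τ))) (Set.Icc a b) := by
    intro τ hτ
    obtain ⟨ε, hε, h⟩ := exists_index_eq_of_norm_sub_lt (hP τ hτ).isFredholm
    have h1 := (hF τ hτ).eventually (Metric.ball_mem_nhds _ hε)
    refine tendsto_const_nhds.congr' ?_
    filter_upwards [h1, self_mem_nhdsWithin] with σ hσ hσ'
    exact (h _ (hP σ hσ').isFredholm (mem_ball_iff_norm.mp hσ)).symm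
  exact isPreconnected_Icc.constant hI hs ht

end

end ChernIndex

end

theorem mainTheorem4 (K : ℕ) :
    (∀ P : ChernIndex.H K →L[ℂ] ChernIndex.H K, ChernIndex.IsLocalizedProjector P →
      ChernIndex.IsBlochDecomposition P (ChernIndex.blochFiber P) ∧
      (∀ k : ℝ × ℝ, IsStarProjection (ChernIndex.blochFiber P k)) ∧
      (∀ α β : Fin K,
        AnalyticOnNhd ℝ (fun k : ℝ × ℝ => ChernIndex.blochFiber P k α β) Set.univ) ∧
      (ChernIndex.fluxCompression P).IsFredholm ∧
      ((ChernIndex.index (ChernIndex.fluxCompression P) : ℤ) : ℂ) =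
        -ChernIndex.chernNumber (ChernIndex.blochFiber P) ∧
      ∃ N : ℤ, ChernIndex.chernNumber (ChernIndex.blochFiber P) = (N : ℂ)) ∧
    (∀ (a b : ℝ) (P : ℝ → (ChernIndex.H K →L[ℂ] ChernIndex.H K)),
      ContinuousOn P (Set.Icc a b) →
      (∀ τ ∈ Set.Icc a b, ChernIndex.IsLocalizedProjector (P τ)) →
      ∀ s ∈ Set.Icc a b, ∀ t ∈ Set.Icc a b,
        ChernIndex.chernNumber (ChernIndex.blochFiber (P s)) =
          ChernIndex.chernNumber (ChernIndex.blochFiber (P t))) := by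
  refine ⟨fun P hP => ⟨hP.isBlochDecomposition, hP.isStarProjection_blochFiber,
    hP.analyticOnNhd_blochFiber, hP.isFredholm, ?_, ?_⟩, fun a b P hc hP s hs t ht => ?_⟩
  · rw [hP.chernNumber_blochFiber, neg_neg]
  · exact ⟨-ChernIndex.index (ChernIndex.fluxCompression P), by
      rw [hP.chernNumber_blochFiber, Int.cast_neg]⟩
  · rw [(hP s hs).chernNumber_blochFiber, (hP t ht).chernNumber_blochFiber,
      ChernIndex.index_fluxCompression_eq_of_continuousOn hc hP hs ht]
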